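/- Let $E$ be a real or complex Hilbert space, let $\Omega$ be the set of positive definite (that is, positive and invertible) bounded operators on $E$, ordered by $A\le B$ iff $B-A$ is positive semidefinite, and equip $\Omega$ with the Thompson metric $$d(A,B)=\max\{\log M(A/B),\log M(B/A)\},\qquad M(A/B)=\inf\{\lambda>0: A\le \lambda B\}.$$ For $A,B\in\Omega$ let $A\#B=A^{1/2}(A^{-1/2}BA^{-1/2})^{1/2}A^{1/2}$, $\mathcal A(A,B)=\frac12(A+B)$ and $\mathcal H(A,B)=2(A^{-1}+B^{-1})^{-1}$ be the geometric, arithmetic and harmonic means. For a binary operation $\nu$ on $\Omega$ put $\lambda_1(A,B)=A\#B$, $\nu_1(A,B)=\nu(A,B)$ and, inductively, $\lambda_{n+1}(A,B)=\lambda_n(A,B)\#\nu_n(A,B)$, $\nu_{n+1}(A,B)=\nu(\lambda_n(A,B),\nu_n(A,B))$. If $\lambda_n(A,B)$ and $\nu_n(A,B)$ converge to a common limit $\mu(A,B)\in\Omega$ for all $A,B\in\Omega$ and $\mu(A,A)=A$ for all $A$, then $\mu$ is the iterated composition of $\#$ and $\nu$. For $\nu=\mathcal A$ it is called the arithmetic-geometric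 mean, for $\nu=\mathcal H$ the harmonic-geometric mean. A $k$-mean on a set $X$ is a map $\mu:X^k\to X$ with $\mu(x,\dots,x)=x$ for all $x$. Its barycentric operator $\beta_\mu:X^{k+1}\to X^{k+1}$ is the map whose $i$-th coordinate is $\mu$ applied to the $k$-tuple obtained by deleting the $i$-th coordinate of the argument. If $X$ is a Hausdorff space and $\mu$ is continuous, a $(k+1)$-mean $\tilde\mu$ is a $\beta$-extension of $\mu$ if $\lim_n\beta_\mu^n(\mathbf x)=(\tilde\mu(\mathbf x),\dots,\tilde\mu(\mathbf x))$ for all $\mathbf x\in X^{k+1}$. On a metric space, $\mu$ is nonexpansive if $d(\mu(\mathbf x),\mu(\mathbf y))\le\max_j d(x_j,y_j)$ for all $\mathbf x,\mathbf y$, and coordinatewise $\rho$-contractive, where $0<\rho<1$, if $d(\mu(\mathbf x),\mu(\mathbf y))\le\rho\, d(x_j,y_j)$ whenever $\mathbf x,\mathbf y$ differ only in the $j$-th coordinate. **Corollary.** Let $\mu$ denote either the arithmetic-geometric mean or the harmonic-geometric mean. Then: 1. $\mu$ exists on $\Omega$; the limits defining it exist in the Thompson metric and in the weak operator topology, and agree.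 2. For every integer $n\ge1$ the order interval $[\frac1nI,nI]=\{A:\frac1nI\le A\le nI\}\subseteq\Omega$ is closed under $\mu$, and on it $\mu$ is nonexpansive and, for some $\rho_n$ with $0<\rho_n<1$, coordinatewise $\rho_n$-contractive with respect to the Thompson metric. 3. On $\Omega$ the mean $\mu$ inductively $\beta$-extends to an $n$-mean for every $n>2$: there are continuous $n$-means $\mu_n:\Omega^n\to\Omega$, $n\ge2$, with $\mu_2=\mu$, such that $\mu_{n+1}$ is a $\beta$-extension of $\mu_n$ for every $n\ge2$. -/

import Mathlib

open Filter Topology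

/-! ### Means on a set, a topological space, a metric space -/

namespace Means

/-- A `k`-mean on `X`: a `k`-ary operation satisfying the generalized idempotency law. -/
def IsMean {X : Type*} {k : ℕ} (μ : (Fin k → X) → X) : Prop :=
  ∀ x : X, μ (fun _ => x) = x

/-- A topological `k`-mean: a continuous `k`-mean on a Hausdorff space. -/
def IsTopologicalMean {X : Type*} [TopologicalSpace X] {k : ℕ} (μ : (Fin k → X) → X) : Prop :=
  T2Space X ∧ Continuous μ ∧ IsMean μ

/-- A binary operation viewed as an operation on pairs. -/
def ofBinary {X : Type*} (σ : X → X → X) : (Fin 2 → X) → X :=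
  fun x => σ (x 0) (x 1)

/-- The barycentric operator `β_μ` of a `k`-mean: the `i`-th coordinate of `β_μ x` is `μ` applied
to `x` with the `i`-th coordinate deleted. -/
def barycentric {X : Type*} {k : ℕ} (μ : (Fin k → X) → X) (x : Fin (k + 1) → X) :
    Fin (k + 1) → X :=
  fun i => μ (i.removeNth x)

/-- The `(k+1)`-mean `ν` is a `β`-extension of the topological `k`-mean `μ`: for every `x`, the
iterates `β_μ^n x` converge to the constant tuple with entries `ν x`. -/
def IsBetaExtension {X : Type*} [TopologicalSpace X] {k : ℕ}
    (μ : (Fin k → X) → X) (ν : (Fin (k + 1) → X) → X) : Prop :=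
  IsTopologicalMean μ ∧ IsMean ν ∧
    ∀ x : Fin (k + 1) → X,
      Tendsto (fun n : ℕ => (barycentric μ)^[n] x) atTop (𝓝 (fun _ => ν x))

/-- The `2`-mean `μ` inductively `β`-extends to an `n`-mean for each `n > 2`: there is a sequence
of continuous `n`-means, `n ≥ 2`, which starts with `μ` and in which each member is a
`β`-extension of the preceding one. (The values `M 0` and `M 1` carry no information.) -/
def InductivelyBetaExtends {X : Type*} [TopologicalSpace X] (μ : (Fin 2 → X) → X) : Prop :=
  ∃ M : (n : ℕ) → (Fin n → X) → X,
    M 2 = μ ∧ ∀ k : ℕ, 2 ≤ k → IsTopologicalMean (M k) ∧ IsBetaExtension (M k) (M (k + 1))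

/-- The subset `S` is closed under `μ` (that is, `S` is convex with respect to `μ`), so that `μ`
restricts to a mean on `S`. -/
def IsConvexFor {X : Type*} {k : ℕ} (μ : (Fin k → X) → X) (S : Set X) : Prop :=
  ∀ x : Fin k → X, (∀ i, x i ∈ S) → μ x ∈ S

/-- `μ` is nonexpansive on `S`: `d(μ x, μ y) ≤ max_j d(x_j, y_j)` for tuples with entries in `S`
(the right-hand side is the sup distance of the tuples `x` and `y`). -/
def IsNonexpansiveOn {X : Type*} [PseudoMetricSpace X] {k : ℕ} (μ : (Fin k → X) → X)
    (S : Set X) : Prop :=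
  ∀ x y : Fin k → X, (∀ i, x i ∈ S) → (∀ i, y i ∈ S) → dist (μ x) (μ y) ≤ dist x y

/-- `μ` is coordinatewise `ρ`-contractive on `S`, where `0 < ρ < 1`: for tuples `x`, `y` with
entries in `S` that differ at most in the `j`-th coordinate, `d(μ x, μ y) ≤ ρ d(x_j, y_j)`. -/
def IsCoordContractiveOn {X : Type*} [PseudoMetricSpace X] {k : ℕ} (ρ : ℝ)
    (μ : (Fin k → X) → X) (S : Set X) : Prop :=
  0 < ρ ∧ ρ < 1 ∧
    ∀ (x y : Fin k → X) (j : Fin k), (∀ i, x i ∈ S) → (∀ i, y i ∈ S) → (∀ i, i ≠ j → x i = y i) →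
      dist (μ x) (μ y) ≤ ρ * dist (x j) (y j)

/-- The pair of iterates: `iterPair σ τ x y n = (σ_{n+1}(x, y), τ_{n+1}(x, y))`, where
`σ_1 = σ`, `τ_1 = τ`, `σ_{n+1} = σ(σ_n, τ_n)` and `τ_{n+1} = τ(σ_n, τ_n)`. -/
def iterPair {X : Type*} (σ τ : X → X → X) (x y : X) : ℕ → X × X
  | 0 => (σ x y, τ x y)
  | n + 1 => (σ (iterPair σ τ x y n).1 (iterPair σ τ x y n).2,
              τ (iterPair σ τ x y n).1 (iterPair σ τ x y n).2)

/-- `μ` is the iterated composition `σ * τ` of the `2`-means `σ` and `τ`. -/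
def IsIteratedComposition {X : Type*} [TopologicalSpace X] (σ τ μ : X → X → X) : Prop :=
  (∀ x, μ x x = x) ∧ ∀ x y,
    Tendsto (fun n => (iterPair σ τ x y n).1) atTop (𝓝 (μ x y)) ∧
    Tendsto (fun n => (iterPair σ τ x y n).2) atTop (𝓝 (μ x y))

end Means

/-! ### Positive definite operators on a (real or complex) Hilbert space -/

/-- The set `Ω` of positive definite (positive and invertible) bounded operators on `E`. -/
def PosDefOp (𝕜 E : Type*) [RCLike 𝕜] [NormedAddCommGroup E] [InnerProductSpace 𝕜 E] : Type _ :=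
  {A : E →L[𝕜] E // IsStrictlyPositive A}

namespace PosDefOp

section Quad

variable {𝕜 E : Type*} [RCLike 𝕜] [NormedAddCommGroup E] [InnerProductSpace 𝕜 E]

theorem le_iff {A B : E →L[𝕜] E} (hA : A.IsSymmetric) (hB : B.IsSymmetric) :
    A ≤ B ↔ ∀ x, RCLike.re (inner 𝕜 (A x) x) ≤ RCLike.re (inner 𝕜 (B x) x) := by
  rw [ContinuousLinearMap.le_def, ContinuousLinearMap.isPositive_def]
  constructor
  · rintro ⟨_, h⟩ x
    have := h x
    simpa [ContinuousLinearMap.reApplyInnerSelf, inner_sub_left] using this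
  · intro h
    refine ⟨?_, fun x => ?_⟩
    · intro x y
      have h1 := hA x y
      have h2 := hB x y
      simp only [ContinuousLinearMap.coe_coe] at h1 h2
      simp [inner_sub_left, inner_sub_right, h1, h2]
    · simpa [ContinuousLinearMap.reApplyInnerSelf, inner_sub_left] using h x

theorem isSymmetric_smul_one (r : ℝ) : ((r : 𝕜) • (1 : E →L[𝕜] E)).IsSymmetric := by
  intro x y
  simp [inner_smul_left, inner_smul_right]

theorem isSymmetric_smul (r : ℝ) {A : E →L[𝕜] E} (hA : A.IsSymmetric) :
    ((r : 𝕜) • A).IsSymmetric := by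
  intro x y
  have h := hA x y
  simp only [ContinuousLinearMap.coe_coe] at h
  simp [inner_smul_left, inner_smul_right, h]

theorem re_inner_smul (r : ℝ) (A : E →L[𝕜] E) (x : E) :
    RCLike.re (inner 𝕜 (((r : 𝕜) • A) x) x) = r * RCLike.re (inner 𝕜 (A x) x) := by
  simp [inner_smul_left]

theorem re_inner_smul_one (r : ℝ) (x : E) :
    RCLike.re (inner 𝕜 (((r : 𝕜) • (1 : E →L[𝕜] E)) x) x) = r * ‖x‖ ^ 2 := by
  rw [re_inner_smul]
  simp

/-- For `X` positive with `⟪X z, z⟫ ≤ q ‖z‖²`, one has `‖X x‖² ≤ q ⟪X x, x⟫`. -/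
theorem norm_sq_le {X : E →L[𝕜] E} (hX : X.IsPositive) {q : ℝ} (hq : 0 < q)
    (h : ∀ z, RCLike.re (inner 𝕜 (X z) z) ≤ q * ‖z‖ ^ 2) (x : E) :
    ‖X x‖ ^ 2 ≤ q * RCLike.re (inner 𝕜 (X x) x) := by
  have h0 := hX.re_inner_nonneg_left (x - ((q⁻¹ : ℝ) : 𝕜) • X x)
  have h1 := h (X x)
  have hs : inner 𝕜 (X (X x)) x = inner 𝕜 (X x) (X x) := hX.isSymmetric (X x) x
  have hexp : RCLike.re (inner 𝕜 (X (x - ((q⁻¹ : ℝ) : 𝕜) • X x)) (x - ((q⁻¹ : ℝ) : 𝕜) • X x))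
      = RCLike.re (inner 𝕜 (X x) x) - 2 * q⁻¹ * ‖X x‖ ^ 2
        + q⁻¹ ^ 2 * RCLike.re (inner 𝕜 (X (X x)) (X x)) := by
    rw [map_sub, map_smul, inner_sub_left, inner_sub_right, inner_sub_right, inner_smul_left,
      inner_smul_left, inner_smul_right, inner_smul_right, hs]
    simp only [RCLike.conj_ofReal, map_sub, RCLike.re_ofReal_mul, inner_self_eq_norm_sq]
    ring
  rw [hexp] at h0
  have h2 : q⁻¹ ^ 2 * RCLike.re (inner 𝕜 (X (X x)) (X x)) ≤ q⁻¹ * ‖X x‖ ^ 2 := by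
    calc _ ≤ q⁻¹ ^ 2 * (q * ‖X x‖ ^ 2) := by gcongr
      _ = _ := by field_simp
  have h3 : q⁻¹ * ‖X x‖ ^ 2 ≤ RCLike.re (inner 𝕜 (X x) x) := by linarith
  calc ‖X x‖ ^ 2 = q * (q⁻¹ * ‖X x‖ ^ 2) := by field_simp
    _ ≤ _ := by gcongr

theorem norm_le {X : E →L[𝕜] E} (hX : X.IsPositive) {q : ℝ} (hq : 0 < q)
    (h : ∀ z, RCLike.re (inner 𝕜 (X z) z) ≤ q * ‖z‖ ^ 2) : ‖X‖ ≤ q := by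
  refine ContinuousLinearMap.opNorm_le_bound _ hq.le fun x => ?_
  have h1 := norm_sq_le hX hq h x
  have h2 := h x
  have : ‖X x‖ ^ 2 ≤ (q * ‖x‖) ^ 2 := by
    calc _ ≤ q * RCLike.re (inner 𝕜 (X x) x) := h1
      _ ≤ q * (q * ‖x‖ ^ 2) := by gcongr
      _ = _ := by ring
  exact le_of_sq_le_sq this (by positivity)

theorem re_inner_le_norm (A : E →L[𝕜] E) (x : E) :
    RCLike.re (inner 𝕜 (A x) x) ≤ ‖A‖ * ‖x‖ ^ 2 := by
  calc _ ≤ ‖inner 𝕜 (A x) x‖ := RCLike.re_le_norm _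
    _ ≤ ‖A x‖ * ‖x‖ := norm_inner_le_norm _ _
    _ ≤ (‖A‖ * ‖x‖) * ‖x‖ := by gcongr; exact A.le_opNorm x
    _ = _ := by ring

theorem isPositive (A : PosDefOp 𝕜 E) : A.1.IsPositive :=
  (ContinuousLinearMap.nonneg_iff_isPositive _).1 A.2.nonneg

theorem isSymmetric (A : PosDefOp 𝕜 E) : A.1.IsSymmetric := A.isPositive.isSymmetric

/-- A positive definite operator is bounded below by a positive multiple of the identity. -/
theorem exists_lower (A : PosDefOp 𝕜 E) :
    ∃ c : ℝ, 0 < c ∧ ∀ x, c * ‖x‖ ^ 2 ≤ RCLike.re (inner 𝕜 (A.1 x) x) := by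
  obtain ⟨B, hB⟩ := A.2.isUnit.exists_left_inv
  set q : ℝ := ‖A.1‖ + 1
  have hq : 0 < q := by positivity
  set b : ℝ := ‖B‖ + 1
  have hb : 0 < b := by positivity
  refine ⟨q⁻¹ * (b ^ 2)⁻¹, by positivity, fun x => ?_⟩
  have h1 := norm_sq_le A.isPositive hq (fun z => (re_inner_le_norm A.1 z).trans (by
    gcongr; simp [q])) x
  have h2 : ‖x‖ ≤ b * ‖A.1 x‖ := by
    calc ‖x‖ = ‖B (A.1 x)‖ := by
          rw [← mul_apply_eq_comp, hB, one_apply_eq_self]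
      _ ≤ ‖B‖ * ‖A.1 x‖ := B.le_opNorm _
      _ ≤ b * ‖A.1 x‖ := by gcongr; simp [b]
  calc q⁻¹ * (b ^ 2)⁻¹ * ‖x‖ ^ 2 ≤ q⁻¹ * (b ^ 2)⁻¹ * (b * ‖A.1 x‖) ^ 2 := by gcongr
    _ = q⁻¹ * ‖A.1 x‖ ^ 2 := by field_simp
    _ ≤ q⁻¹ * (q * RCLike.re (inner 𝕜 (A.1 x) x)) := by gcongr
    _ = _ := by field_simp

theorem isStrictlyPositive_of_lower [CompleteSpace E] {A : E →L[𝕜] E} (hA : A.IsSymmetric) {c : ℝ}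
    (hc : 0 < c) (h : ∀ x, c * ‖x‖ ^ 2 ≤ RCLike.re (inner 𝕜 (A x) x)) :
    IsStrictlyPositive A := by
  refine ⟨(ContinuousLinearMap.nonneg_iff_isPositive _).2 ⟨hA, fun x => ?_⟩, ?_⟩
  · exact le_trans (by positivity) (h x)
  · refine ContinuousLinearMap.isUnit_of_forall_le_norm_inner_map A (c := ⟨c, hc.le⟩) hc fun x => ?_
    calc ‖x‖ ^ 2 * c = c * ‖x‖ ^ 2 := mul_comm _ _
      _ ≤ _ := h x
      _ ≤ _ := RCLike.re_le_norm _

theorem eq_of_mul_self_eq {S T : PosDefOp 𝕜 E} (h : S.1 * S.1 = T.1 * T.1) : S = T := by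
  obtain ⟨c, hc, hS⟩ := S.exists_lower
  obtain ⟨b, hb, hT⟩ := T.exists_lower
  set D : E →L[𝕜] E := S.1 - T.1 with hD
  have hcomm : S.1 * D = -(D * T.1) := by
    rw [hD, mul_sub, h]
    noncomm_ring
  set t : ℝ := ‖T.1‖ + b with ht
  have ht0 : 0 < t := by positivity
  -- `t - T` has norm at most `t`, while `t + S` is bounded below by `t + c`
  have hn : ‖((t : ℝ) : 𝕜) • (1 : E →L[𝕜] E) - T.1‖ ≤ t := by
    have hre : ∀ x, RCLike.re (inner 𝕜 ((((t : ℝ) : 𝕜) • (1 : E →L[𝕜] E) - T.1) x) x)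
        = t * ‖x‖ ^ 2 - RCLike.re (inner 𝕜 (T.1 x) x) := fun x => by
      rw [sub_apply, inner_sub_left, map_sub, re_inner_smul_one]
    refine norm_le ⟨LinearMap.IsSymmetric.sub (isSymmetric_smul_one t) T.isSymmetric,
      fun x => ?_⟩ ht0 fun x => ?_
    · have h1 := hre x
      have h2 := re_inner_le_norm T.1 x
      have h3 : 0 ≤ b * ‖x‖ ^ 2 := by positivity
      change 0 ≤ RCLike.re (inner 𝕜 ((((t : ℝ) : 𝕜) • (1 : E →L[𝕜] E) - T.1) x) x)
      rw [h1, ht]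
      linarith
    · rw [hre]
      have := T.isPositive.re_inner_nonneg_left x
      linarith
  have hkey : ∀ x, (t + c) * ‖D x‖ ≤ ‖D‖ * t * ‖x‖ := fun x => by
    have e1 : ((t : ℝ) : 𝕜) • D x + S.1 (D x)
        = D ((((t : ℝ) : 𝕜) • (1 : E →L[𝕜] E) - T.1) x) := by
      have := congrArg (fun F : E →L[𝕜] E => F x) hcomm
      simp only [mul_apply_eq_comp, neg_apply] at this
      rw [this]
      simp [sub_eq_add_neg]
    have e2 : (t + c) * ‖D x‖ ^ 2 ≤ ‖((t : ℝ) : 𝕜) • D x + S.1 (D x)‖ * ‖D x‖ := by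
      refine le_trans ?_ ((RCLike.re_le_norm _).trans (norm_inner_le_norm (𝕜 := 𝕜) _ _))
      rw [inner_add_left, map_add, inner_smul_left, RCLike.conj_ofReal, RCLike.re_ofReal_mul,
        inner_self_eq_norm_sq]
      have := hS (D x)
      linarith
    have e3 : ‖((t : ℝ) : 𝕜) • D x + S.1 (D x)‖ ≤ ‖D‖ * t * ‖x‖ := by
      rw [e1]
      refine (D.le_opNorm _).trans ?_
      rw [mul_assoc]
      gcongr
      refine (ContinuousLinearMap.le_opNorm _ _).trans ?_
      gcongr
    rcases (norm_nonneg (D x)).eq_or_lt with h0 | h0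
    · rw [← h0]
      simp only [mul_zero]
      positivity
    · have : (t + c) * ‖D x‖ ≤ ‖((t : ℝ) : 𝕜) • D x + S.1 (D x)‖ := by
        refine le_of_mul_le_mul_right ?_ h0
        calc _ = (t + c) * ‖D x‖ ^ 2 := by ring
          _ ≤ _ := e2
      exact this.trans e3
  have hDn : ‖D‖ ≤ ‖D‖ * t / (t + c) := by
    refine ContinuousLinearMap.opNorm_le_bound _ (by positivity) fun x => ?_
    rw [div_mul_eq_mul_div, le_div_iff₀ (by positivity), mul_comm]
    exact hkey x
  have hD0 : D = 0 := by
    rw [← norm_eq_zero]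
    rw [le_div_iff₀ (by positivity)] at hDn
    have := norm_nonneg D
    nlinarith
  exact Subtype.ext (sub_eq_zero.1 hD0)

end Quad

section Operations

variable {𝕜 E : Type*} [RCLike 𝕜] [NormedAddCommGroup E] [InnerProductSpace 𝕜 E] [CompleteSpace E]

/-- The sum `A + B`. -/
def add (A B : PosDefOp 𝕜 E) : PosDefOp 𝕜 E :=
  ⟨A.1 + B.1, by
    obtain ⟨c, hc, h⟩ := A.exists_lower
    refine isStrictlyPositive_of_lower (A.isPositive.add B.isPositive).isSymmetric hc fun x => ?_
    have := B.isPositive.re_inner_nonneg_left x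
    have := h x
    simp only [add_apply, inner_add_left, map_add]
    linarith⟩

/-- The multiple `r A` by a real number `r > 0`. -/
def rsmul (r : ℝ) (hr : 0 < r) (A : PosDefOp 𝕜 E) : PosDefOp 𝕜 E :=
  ⟨(r : 𝕜) • A.1, by
    obtain ⟨c, hc, h⟩ := A.exists_lower
    refine isStrictlyPositive_of_lower (isSymmetric_smul r A.isSymmetric)
      (mul_pos hr hc) fun x => ?_
    rw [re_inner_smul, mul_assoc]
    exact mul_le_mul_of_nonneg_left (h x) hr.le⟩

/-- The inverse operator `A⁻¹`. -/
noncomputable def inv (A : PosDefOp 𝕜 E) : PosDefOp 𝕜 E :=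
  ⟨((A.2.isUnit.unit⁻¹ : (E →L[𝕜] E)ˣ) : E →L[𝕜] E), by
    set B : E →L[𝕜] E := ((A.2.isUnit.unit⁻¹ : (E →L[𝕜] E)ˣ) : E →L[𝕜] E) with hB
    have hAB : ∀ x, A.1 (B x) = x := fun x => by
      rw [← mul_apply_eq_comp, hB, IsUnit.mul_val_inv, one_apply_eq_self]
    refine ⟨(ContinuousLinearMap.nonneg_iff_isPositive _).2 ⟨fun x y => ?_, fun x => ?_⟩,
      Units.isUnit _⟩
    · have h := A.isSymmetric (B x) (B y)
      simp only [ContinuousLinearMap.coe_coe, hAB] at h ⊢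
      exact h.symm
    · have h := A.isPositive.re_inner_nonneg_right (B x)
      rw [hAB] at h
      exact h⟩

/-- The congruence transform `S B S` for `S`, `B` in `Ω`. -/
def conj (S B : PosDefOp 𝕜 E) : PosDefOp 𝕜 E :=
  ⟨S.1 * B.1 * S.1, by
    have hS : ∀ x y, inner 𝕜 (S.1 x) y = inner 𝕜 x (S.1 y) := fun x y => S.isSymmetric x y
    have hB : ∀ x y, inner 𝕜 (B.1 x) y = inner 𝕜 x (B.1 y) := fun x y => B.isSymmetric x y
    refine ⟨(ContinuousLinearMap.nonneg_iff_isPositive _).2 ⟨fun x y => ?_, fun x => ?_⟩,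
      (S.2.isUnit.mul B.2.isUnit).mul S.2.isUnit⟩
    · simp only [ContinuousLinearMap.coe_coe, mul_apply_eq_comp, hS, hB]
    · simp only [ContinuousLinearMap.reApplyInnerSelf, mul_apply_eq_comp, hS]
      exact B.isPositive.re_inner_nonneg_left _⟩

theorem exists_sqrt (A : PosDefOp 𝕜 E) : ∃ S : PosDefOp 𝕜 E, S.1 * S.1 = A.1 := by
  obtain ⟨c, hc, hlow⟩ := A.exists_lower
  set K : ℝ := ‖A.1‖ + 1 with hK
  have hK1 : 1 ≤ K := by simp [hK]
  have hK0 : 0 < K := by linarith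
  set a : ℝ := min c (1 / 2) with ha
  have ha0 : 0 < a := lt_min hc (by norm_num)
  have ha1 : a ≤ 1 / 2 := min_le_right _ _
  set q : ℝ := 1 - a / K with hq
  have haK : 0 < a / K := by positivity
  have haK' : a / K ≤ 1 / 2 := (div_le_self ha0.le hK1).trans ha1
  have hq0 : 0 < q := by linarith
  have hq1 : q < 1 := by linarith
  set X : E →L[𝕜] E := 1 - ((K⁻¹ : ℝ) : 𝕜) • A.1 with hX
  have hXre : ∀ x, RCLike.re (inner 𝕜 (X x) x)
      = ‖x‖ ^ 2 - K⁻¹ * RCLike.re (inner 𝕜 (A.1 x) x) := fun x => by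
    rw [hX, sub_apply, inner_sub_left, map_sub, re_inner_smul, one_apply_eq_self,
      inner_self_eq_norm_sq]
  have hXpos : X.IsPositive := by
    refine ⟨LinearMap.IsSymmetric.sub (fun x y => rfl) (isSymmetric_smul _ A.isSymmetric),
      fun x => ?_⟩
    have h1 := re_inner_le_norm A.1 x
    have h2 : K⁻¹ * RCLike.re (inner 𝕜 (A.1 x) x) ≤ ‖x‖ ^ 2 := by
      rw [inv_mul_le_iff₀ hK0]
      refine h1.trans ?_
      gcongr
      simp [hK]
    have h3 := hXre x
    change 0 ≤ RCLike.re (inner 𝕜 (X x) x)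
    linarith
  have hXq : ∀ x, RCLike.re (inner 𝕜 (X x) x) ≤ q * ‖x‖ ^ 2 := fun x => by
    rw [hXre]
    have h1 : a * ‖x‖ ^ 2 ≤ RCLike.re (inner 𝕜 (A.1 x) x) :=
      le_trans (by gcongr; exact min_le_left _ _) (hlow x)
    have h2 : a / K * ‖x‖ ^ 2 ≤ K⁻¹ * RCLike.re (inner 𝕜 (A.1 x) x) := by
      rw [div_eq_inv_mul, mul_assoc]
      gcongr
    rw [hq]
    linarith
  have hXn : ‖X‖ ≤ q := norm_le hXpos hq0 hXq
  have hXsa : IsSelfAdjoint X := hXpos.isSelfAdjoint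
  set f : (E →L[𝕜] E) → (E →L[𝕜] E) := fun Y => ((2⁻¹ : ℝ) : 𝕜) • (X + Y * Y) with hf
  have h2n : ‖((2⁻¹ : ℝ) : 𝕜)‖ = 2⁻¹ := by
    rw [RCLike.norm_ofReal]; norm_num
  set s : Set (E →L[𝕜] E) := {Y | ‖Y‖ ≤ q ∧ IsSelfAdjoint Y} with hs
  have hsc : IsClosed s := by
    refine IsClosed.inter (isClosed_le continuous_norm continuous_const) ?_
    exact isClosed_eq continuous_star continuous_id
  have hsf : Set.MapsTo f s s := by
    rintro Y ⟨hYn, hYs⟩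
    refine ⟨?_, ?_⟩
    · calc ‖f Y‖ = 2⁻¹ * ‖X + Y * Y‖ := by rw [hf]; simp only [norm_smul, h2n]
        _ ≤ 2⁻¹ * (q + q * q) := by
          gcongr
          refine (norm_add_le _ _).trans (add_le_add hXn ((norm_mul_le _ _).trans ?_))
          gcongr
        _ ≤ q := by nlinarith
    · have : IsSelfAdjoint (X + Y * Y) := by
        refine hXsa.add ?_
        rw [IsSelfAdjoint, star_mul, hYs.star_eq]
      refine IsSelfAdjoint.smul ?_ this
      simp [IsSelfAdjoint]
  have hcon : ContractingWith ⟨q, hq0.le⟩ (hsf.restrict f s s) := by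
    refine ⟨by exact_mod_cast hq1, LipschitzWith.of_dist_le_mul ?_⟩
    rintro ⟨Y, hYn, hYs⟩ ⟨Z, hZn, hZs⟩
    rw [Subtype.dist_eq, Subtype.dist_eq, Set.MapsTo.val_restrict_apply,
      Set.MapsTo.val_restrict_apply, dist_eq_norm, dist_eq_norm]
    have hid : f Y - f Z = ((2⁻¹ : ℝ) : 𝕜) • (Y * (Y - Z) + (Y - Z) * Z) := by
      simp only [hf, ← smul_sub]
      congr 1
      noncomm_ring
    rw [hid, norm_smul, h2n]
    calc 2⁻¹ * ‖Y * (Y - Z) + (Y - Z) * Z‖ ≤ 2⁻¹ * (q * ‖Y - Z‖ + ‖Y - Z‖ * q) := by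
          gcongr
          refine (norm_add_le _ _).trans (add_le_add ((norm_mul_le _ _).trans ?_)
            ((norm_mul_le _ _).trans ?_))
          · gcongr
          · gcongr
      _ = q * ‖Y - Z‖ := by ring
  obtain ⟨Y, ⟨hYn, hYs⟩, hfix, -⟩ := hcon.exists_fixedPoint' hsc.isComplete hsf
    (x := 0) ⟨by simpa using hq0.le, by simp⟩ (edist_ne_top _ _)
  have hfix' : ((2⁻¹ : ℝ) : 𝕜) • (X + Y * Y) = Y := hfix
  have hYY : X + Y * Y = Y + Y := by
    have h2 : (2 : 𝕜) * ((2⁻¹ : ℝ) : 𝕜) = 1 := by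
      rw [RCLike.ofReal_inv, RCLike.ofReal_ofNat]
      exact mul_inv_cancel₀ two_ne_zero
    calc X + Y * Y = (2 : 𝕜) • (((2⁻¹ : ℝ) : 𝕜) • (X + Y * Y)) := by rw [smul_smul, h2, one_smul]
      _ = Y + Y := by rw [hfix', two_smul]
  have hYsym : Y.IsSymmetric := ContinuousLinearMap.isSelfAdjoint_iff_isSymmetric.1 hYs
  have hsq : (1 - Y) * (1 - Y) = ((K⁻¹ : ℝ) : 𝕜) • A.1 := by
    have : (1 - Y) * (1 - Y) = 1 - (Y + Y) + Y * Y := by noncomm_ring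
    rw [this, ← hYY, hX]
    abel
  have hS0 : IsStrictlyPositive (1 - Y) := by
    refine isStrictlyPositive_of_lower (c := 1 - q)
      (LinearMap.IsSymmetric.sub (fun x y => rfl) hYsym) (by linarith) fun x => ?_
    rw [sub_apply, inner_sub_left, map_sub, one_apply_eq_self, inner_self_eq_norm_sq]
    have := re_inner_le_norm Y x
    have : ‖Y‖ * ‖x‖ ^ 2 ≤ q * ‖x‖ ^ 2 := by gcongr
    linarith
  refine ⟨rsmul (√K) (Real.sqrt_pos.2 hK0) ⟨1 - Y, hS0⟩, ?_⟩
  change ((√K : ℝ) : 𝕜) • (1 - Y) * ((√K : ℝ) : 𝕜) • (1 - Y) = A.1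
  rw [smul_mul_smul_comm, hsq, smul_smul, ← RCLike.ofReal_mul, ← RCLike.ofReal_mul,
    Real.mul_self_sqrt hK0.le, mul_inv_cancel₀ hK0.ne', RCLike.ofReal_one, one_smul]

/-- Every positive definite operator has exactly one positive definite square root. -/
theorem existsUnique_sqrt (A : PosDefOp 𝕜 E) : ∃! S : PosDefOp 𝕜 E, S.1 * S.1 = A.1 := by
  obtain ⟨S, hS⟩ := A.exists_sqrt
  exact ⟨S, hS, fun T hT => eq_of_mul_self_eq (hT.trans hS.symm)⟩

/-- The positive square root `A^{1/2}`. -/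
noncomputable def sqrt (A : PosDefOp 𝕜 E) : PosDefOp 𝕜 E := A.existsUnique_sqrt.choose

/-- The geometric mean `A # B = A^{1/2} (A^{-1/2} B A^{-1/2})^{1/2} A^{1/2}`. -/
noncomputable def geomMean (A B : PosDefOp 𝕜 E) : PosDefOp 𝕜 E :=
  conj (sqrt A) (sqrt (conj (inv (sqrt A)) B))

/-- The arithmetic mean `(A + B) / 2`. -/
noncomputable def arithMean (A B : PosDefOp 𝕜 E) : PosDefOp 𝕜 E :=
  rsmul (1 / 2) (by norm_num) (add A B)

/-- The harmonic mean `2 (A⁻¹ + B⁻¹)⁻¹`. -/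
noncomputable def harmMean (A B : PosDefOp 𝕜 E) : PosDefOp 𝕜 E :=
  rsmul 2 (by norm_num) (inv (add (inv A) (inv B)))

end Operations

/-- The order interval `[(1/n) I, n I]` in `Ω`. -/
def orderInterval (𝕜 E : Type*) [RCLike 𝕜] [NormedAddCommGroup E] [InnerProductSpace 𝕜 E]
    (n : ℕ) : Set (PosDefOp 𝕜 E) :=
  {A | ((1 / n : ℝ) : 𝕜) • (1 : E →L[𝕜] E) ≤ A.1 ∧ A.1 ≤ ((n : ℝ) : 𝕜) • (1 : E →L[𝕜] E)}

section Thompson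

variable {𝕜 E : Type*} [RCLike 𝕜] [NormedAddCommGroup E] [InnerProductSpace 𝕜 E]

/-- `M(A/B) = inf {r > 0 : A ≤ r B}`. -/
noncomputable def M (A B : PosDefOp 𝕜 E) : ℝ := sInf {r : ℝ | 0 < r ∧ A.1 ≤ (r : 𝕜) • B.1}

/-- The Thompson distance `d(A, B) = max {log M(A/B), log M(B/A)}`. -/
noncomputable def thompsonDist (A B : PosDefOp 𝕜 E) : ℝ :=
  max (Real.log (M A B)) (Real.log (M B A))

theorem le_smul_iff (A B : PosDefOp 𝕜 E) (r : ℝ) : A.1 ≤ (r : 𝕜) • B.1 ↔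
    ∀ x, RCLike.re (inner 𝕜 (A.1 x) x) ≤ r * RCLike.re (inner 𝕜 (B.1 x) x) := by
  rw [le_iff A.isSymmetric (isSymmetric_smul r B.isSymmetric)]
  simp only [re_inner_smul]

theorem bddBelow_M (A B : PosDefOp 𝕜 E) :
    BddBelow {r : ℝ | 0 < r ∧ A.1 ≤ (r : 𝕜) • B.1} := ⟨0, fun _ h => h.1.le⟩

theorem M_le {A B : PosDefOp 𝕜 E} {r : ℝ} (hr : 0 < r) (h : A.1 ≤ (r : 𝕜) • B.1) : M A B ≤ r :=
  csInf_le (bddBelow_M A B) ⟨hr, h⟩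

theorem le_M_smul (A B : PosDefOp 𝕜 E) : A.1 ≤ ((M A B : ℝ) : 𝕜) • B.1 := by
  have hne : {r : ℝ | 0 < r ∧ A.1 ≤ (r : 𝕜) • B.1}.Nonempty := by
    obtain ⟨c, hc, h⟩ := B.exists_lower
    refine ⟨(‖A.1‖ + 1) * c⁻¹, by positivity, (le_smul_iff _ _ _).2 fun x => ?_⟩
    calc _ ≤ ‖A.1‖ * ‖x‖ ^ 2 := re_inner_le_norm _ _
      _ ≤ (‖A.1‖ + 1) * ‖x‖ ^ 2 := by gcongr; simp
      _ = (‖A.1‖ + 1) * c⁻¹ * (c * ‖x‖ ^ 2) := by field_simp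
      _ ≤ _ := by gcongr; exact h x
  rw [le_smul_iff]
  intro x
  rcases (B.isPositive.re_inner_nonneg_left x).eq_or_lt with h0 | h0
  · obtain ⟨r, hr, hle⟩ := hne
    have := (le_smul_iff _ _ _).1 hle x
    rw [← h0] at this ⊢
    simpa using this
  · rw [← div_le_iff₀ h0]
    refine le_csInf hne fun r hr => ?_
    rw [div_le_iff₀ h0]
    exact (le_smul_iff _ _ _).1 hr.2 x

theorem re_inner_pos (A : PosDefOp 𝕜 E) {x : E} (hx : x ≠ 0) :
    0 < RCLike.re (inner 𝕜 (A.1 x) x) := by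
  obtain ⟨c, hc, h⟩ := A.exists_lower
  have : 0 < ‖x‖ := norm_pos_iff.2 hx
  exact lt_of_lt_of_le (by positivity) (h x)

theorem M_pos [Nontrivial E] (A B : PosDefOp 𝕜 E) : 0 < M A B := by
  obtain ⟨x, hx⟩ := exists_ne (0 : E)
  have h := (le_smul_iff _ _ _).1 (le_M_smul A B) x
  have hA := A.re_inner_pos hx
  have hB := B.re_inner_pos hx
  by_contra hM
  nlinarith [not_lt.1 hM]

theorem M_self [Nontrivial E] (A : PosDefOp 𝕜 E) : M A A = 1 := by
  refine le_antisymm (M_le one_pos (by simp)) ?_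
  obtain ⟨x, hx⟩ := exists_ne (0 : E)
  have h := (le_smul_iff _ _ _).1 (le_M_smul A A) x
  have hA := A.re_inner_pos hx
  by_contra hM
  nlinarith [not_le.1 hM]

theorem M_mul [Nontrivial E] (A B C : PosDefOp 𝕜 E) : M A C ≤ M A B * M B C := by
  refine M_le (mul_pos (M_pos _ _) (M_pos _ _)) ((le_smul_iff _ _ _).2 fun x => ?_)
  have h1 := (le_smul_iff _ _ _).1 (le_M_smul A B) x
  have h2 := (le_smul_iff _ _ _).1 (le_M_smul B C) x
  calc _ ≤ _ := h1
    _ ≤ M A B * (M B C * RCLike.re (inner 𝕜 (C.1 x) x)) := by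
      gcongr; exact (M_pos _ _).le
    _ = _ := by ring

theorem log_M_le [Nontrivial E] (A B C : PosDefOp 𝕜 E) :
    Real.log (M A C) ≤ Real.log (M A B) + Real.log (M B C) := by
  rw [← Real.log_mul (M_pos _ _).ne' (M_pos _ _).ne']
  exact Real.log_le_log (M_pos _ _) (M_mul _ _ _)

theorem le_of_log_M_le [Nontrivial E] {A B : PosDefOp 𝕜 E} (h : Real.log (M A B) ≤ 0) :
    A.1 ≤ B.1 := by
  have h1 : M A B ≤ 1 := by
    rwa [Real.log_nonpos_iff (M_pos _ _).le] at h
  rw [le_iff A.isSymmetric B.isSymmetric]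
  intro x
  have h2 := (le_smul_iff _ _ _).1 (le_M_smul A B) x
  have := B.isPositive.re_inner_nonneg_left x
  nlinarith

theorem thompsonDist_self (A : PosDefOp 𝕜 E) : thompsonDist A A = 0 := by
  rcases subsingleton_or_nontrivial E with hE | hE
  · have h : {r : ℝ | 0 < r ∧ A.1 ≤ (r : 𝕜) • A.1} = Set.Ioi 0 := by
      ext r
      simp only [Set.mem_ofPred_eq, Set.mem_Ioi, and_iff_left_iff_imp]
      exact fun _ => (Subsingleton.elim _ _).le
    have hM : M A A = 0 := by rw [M, h, csInf_Ioi]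
    simp [thompsonDist, hM]
  · simp [thompsonDist, M_self]

/-- `Ω` with the Thompson metric. -/
noncomputable instance : MetricSpace (PosDefOp 𝕜 E) where
  dist := thompsonDist
  dist_self := thompsonDist_self
  dist_comm A B := max_comm _ _
  dist_triangle A B C := by
    rcases subsingleton_or_nontrivial E with hE | hE
    · have hAB : A = B := Subtype.ext (Subsingleton.elim _ _)
      have hBC : B = C := Subtype.ext (Subsingleton.elim _ _)
      subst hAB hBC
      simp [thompsonDist_self]
    · refine max_le ?_ ?_
      · exact (log_M_le A B C).trans (add_le_add (le_max_left _ _) (le_max_left _ _))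
      · refine (log_M_le C B A).trans ?_
        rw [add_comm]
        exact add_le_add (le_max_right _ _) (le_max_right _ _)
  eq_of_dist_eq_zero {A B} h := by
    rcases subsingleton_or_nontrivial E with hE | hE
    · exact Subtype.ext (Subsingleton.elim _ _)
    · exact Subtype.ext (le_antisymm (le_of_log_M_le ((le_max_left _ _).trans h.le))
        (le_of_log_M_le ((le_max_right _ _).trans h.le)))

theorem dist_def (A B : PosDefOp 𝕜 E) : dist A B = thompsonDist A B := rfl

end Thompson

/-- `μ` is the iterated composition `σ * τ` of the operator means `σ` and `τ` on `Ω`: both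
sequences of iterates `σ_n(A, B)` and `τ_n(A, B)` converge to `μ(A, B)`, in the Thompson metric and
also, as operators, in the weak operator topology. -/
def IsIteratedOpMean {𝕜 E : Type*} [RCLike 𝕜] [NormedAddCommGroup E] [InnerProductSpace 𝕜 E]
    (σ τ μ : PosDefOp 𝕜 E → PosDefOp 𝕜 E → PosDefOp 𝕜 E) : Prop :=
  Means.IsIteratedComposition σ τ μ ∧ ∀ A B : PosDefOp 𝕜 E,
    Tendsto (fun n => ContinuousLinearMapWOT.ofCLM (Means.iterPair σ τ A B n).1.1) atTop
      (𝓝 (ContinuousLinearMapWOT.ofCLM (μ A B).1)) ∧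
    Tendsto (fun n => ContinuousLinearMapWOT.ofCLM (Means.iterPair σ τ A B n).2.1) atTop
      (𝓝 (ContinuousLinearMapWOT.ofCLM (μ A B).1))

end PosDefOp

/-!
The theorem splits into an argument about means on complete metric spaces and a few inequalities for
the Thompson metric.

*Metric part.* `Means.IsBddContractive` is the class of nonexpansive `k`-means that are
coordinatewise contractive on each bounded set. It is stable under both constructions of the
theorem. If `σ`, `τ` are binary means in this class with `d(σ(x, y), τ(x, y)) ≤ c d(x, y)` for some
`c < 1`, the gaps `d(σ_n, τ_n)` decay geometrically and bound `d(σ_(n+1), σ_n)`, so the iterates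
converge; the limit inherits both properties, since after the first, contracting step all others are
nonexpansive (`Means.exists_iteratedComposition`). If `μ` is in this class, then deleting the `i`-th
or the `(i+1)`-st coordinate of `x` gives tuples that differ in one coordinate only, so `β_μ`
contracts the distances of neighbouring coordinates; these control the diameter of the tuple and
`d(β_μ x, x)`, so `β_μ^n x` converges to a constant tuple, and the `β`-extension is in the class
again (`Means.IsBddContractive.exists_betaExtension`). Bounded sets take the place of the whole
space because the contraction factor of the arithmetic mean degenerates at infinity; balls are
invariant under nonexpansive means, so nothing is lost.

*Operator part.* The order interval `[(1/n) I, n I]` is the Thompson ball of radius `log n` around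
`I`. The Thompson metric is complete and finer than the norm topology, hence finer than the weak
operator topology. `A # B` is the only `G` with `G A⁻¹ G = B`, and `X ↦ X P X` reflects the order
(`PosDefOp.form_le_of_riccati_le`); together with antitonicity of the inverse this gives
`d(A # B, C # D) ≤ (d(A, C) + d(B, D)) / 2`, and so `A # B` has distance at most `d(A, B) / 2` from
`A` and from `B`, hence from `(A + B) / 2`. The arithmetic mean is contractive in each variable on
bounded sets by an elementary estimate of a logarithm of a sum of exponentials. The harmonic mean
is the arithmetic mean conjugated by the isometry `A ↦ A⁻¹`, which is an automorphism of `#`, so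
the estimates for the arithmetic mean carry over.
-/

namespace Means

/-! ### Barycentric operators of contractive means -/

section Abstract

variable {X : Type*} [MetricSpace X] {k : ℕ}

/-- The class of `k`-means which is stable under iterated composition and under `β`-extension:
nonexpansive means which are coordinatewise `ρ`-contractive on every bounded set, with `ρ`
depending on the set. -/
structure IsBddContractive (μ : (Fin k → X) → X) : Prop where
  isMean : IsMean μ
  nonexpansive : IsNonexpansiveOn μ Set.univ
  contractive : ∀ S : Set X, Bornology.IsBounded S → ∃ ρ : ℝ, IsCoordContractiveOn ρ μ S

namespace IsBddContractive

variable {μ : (Fin k → X) → X}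

theorem dist_le (h : IsBddContractive μ) (x y : Fin k → X) : dist (μ x) (μ y) ≤ dist x y :=
  h.nonexpansive x y (fun _ => Set.mem_univ _) fun _ => Set.mem_univ _

theorem isTopologicalMean (h : IsBddContractive μ) : IsTopologicalMean μ :=
  ⟨inferInstance, (LipschitzWith.of_dist_le_mul (K := 1) fun x y => by
    simpa using h.dist_le x y).continuous, h.isMean⟩

theorem dist_le_of_forall (h : IsBddContractive μ) {x : Fin k → X} {z : X} {r : ℝ} (hr : 0 ≤ r)
    (hx : ∀ i, dist (x i) z ≤ r) : dist (μ x) z ≤ r := by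
  conv_lhs => rw [← h.isMean z]
  exact (h.dist_le _ _).trans ((dist_pi_le_iff hr).2 hx)

theorem isConvexFor_closedBall (h : IsBddContractive μ) (z : X) {r : ℝ} (hr : 0 ≤ r) :
    IsConvexFor μ (Metric.closedBall z r) :=
  fun _ hx => h.dist_le_of_forall hr hx

theorem dist_barycentric_le (h : IsBddContractive μ) (x y : Fin (k + 1) → X) :
    dist (barycentric μ x) (barycentric μ y) ≤ dist x y :=
  (dist_pi_le_iff dist_nonneg).2 fun _ => (h.dist_le _ _).trans
    ((dist_pi_le_iff dist_nonneg).2 fun _ => dist_le_pi_dist x y _)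

theorem dist_barycentric_iterate_le (h : IsBddContractive μ) (x y : Fin (k + 1) → X) (n : ℕ) :
    dist ((barycentric μ)^[n] x) ((barycentric μ)^[n] y) ≤ dist x y := by
  induction n with
  | zero => exact le_rfl
  | succ n ih =>
    rw [Function.iterate_succ_apply', Function.iterate_succ_apply']
    exact (h.dist_barycentric_le _ _).trans ih

theorem barycentric_mem (h : IsBddContractive μ) {z : X} {r : ℝ} (hr : 0 ≤ r)
    {x : Fin (k + 1) → X} (hx : ∀ i, x i ∈ Metric.closedBall z r) (n : ℕ) (i : Fin (k + 1)) :
    (barycentric μ)^[n] x i ∈ Metric.closedBall z r := by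
  induction n generalizing i with
  | zero => exact hx i
  | succ n ih =>
    rw [Function.iterate_succ_apply']
    exact h.isConvexFor_closedBall z hr _ fun j => ih _

end IsBddContractive

/-- Deleting neighbouring coordinates of `x` gives tuples that differ in one coordinate only, so
`β_μ` contracts the distances between neighbouring coordinates. -/
theorem IsCoordContractiveOn.dist_barycentric_succ_le {μ : (Fin k → X) → X} {ρ : ℝ} {S : Set X}
    (h : IsCoordContractiveOn ρ μ S) {x : Fin (k + 1) → X} (hx : ∀ i, x i ∈ S) (i : Fin k) :
    dist (barycentric μ x i.castSucc) (barycentric μ x i.succ)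
      ≤ ρ * dist (x i.castSucc) (x i.succ) := by
  have h1 := h.2.2 (i.castSucc.removeNth x) (i.succ.removeNth x) i (fun _ => hx _) (fun _ => hx _)
    (fun j hj => ?_)
  · simpa [Fin.removeNth, barycentric, dist_comm] using h1
  · simp only [Fin.removeNth]
    congr 1
    rcases lt_or_gt_of_ne hj with hlt | hlt
    · rw [Fin.succAbove_of_castSucc_lt _ _ (by simpa using hlt),
        Fin.succAbove_of_castSucc_lt _ _ (by
          simpa [Fin.lt_def] using (Fin.lt_def.1 hlt).trans (Nat.lt_succ_self _))]
    · rw [Fin.succAbove_of_le_castSucc _ _ (by simpa using hlt.le),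
        Fin.succAbove_of_le_castSucc _ _ (by
          simpa [Fin.le_def] using Nat.succ_le_of_lt (Fin.lt_def.1 hlt))]

/-- If neighbouring coordinates are `b`-close, then any two coordinates are `2kb`-close. -/
theorem dist_coord_le {x : Fin (k + 1) → X} {b : ℝ}
    (h : ∀ i : Fin k, dist (x i.castSucc) (x i.succ) ≤ b) (i j : Fin (k + 1)) :
    dist (x i) (x j) ≤ 2 * k * b := by
  have key : ∀ i : Fin (k + 1), dist (x 0) (x i) ≤ k * b := by
    have h0 : ∀ i : Fin (k + 1), dist (x 0) (x i) ≤ (i : ℕ) * b := by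
      intro i
      induction i using Fin.induction with
      | zero => simp
      | succ i ih =>
        have := dist_triangle (x 0) (x i.castSucc) (x i.succ)
        have := h i
        simp only [Fin.val_castSucc, Fin.val_succ, Nat.cast_add, Nat.cast_one] at ih ⊢
        linarith
    intro i
    rcases Nat.eq_zero_or_pos k with rfl | hk
    · have : i = 0 := Fin.ext (by omega)
      simp [this]
    · have hb : 0 ≤ b := dist_nonneg.trans (h ⟨0, hk⟩)
      refine (h0 i).trans ?_
      gcongr
      omega
  have := dist_triangle_left (x i) (x j) (x 0)
  have := key i
  have := key j
  linarith

/-- The iterates of `β_μ` converge to a constant tuple. The neighbour distances decay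
geometrically, and they control both the diameter of `β_μ^n x` and the distance to
`β_μ^(n+1) x`. -/
theorem IsBddContractive.exists_tendsto [CompleteSpace X] {μ : (Fin k → X) → X}
    (h : IsBddContractive μ) (x : Fin (k + 1) → X) :
    ∃ z : X, Tendsto (fun n : ℕ => (barycentric μ)^[n] x) atTop (𝓝 (fun _ => z)) := by
  set r : ℝ := dist x (fun _ => x 0) with hr
  have hr0 : 0 ≤ r := dist_nonneg
  have hx : ∀ i, x i ∈ Metric.closedBall (x 0) r := fun i => dist_le_pi_dist x (fun _ => x 0) i
  obtain ⟨ρ, hρ⟩ := h.contractive _ (Metric.isBounded_closedBall (x := x 0) (r := r))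
  set b : ℝ := dist (fun i : Fin k => x i.castSucc) (fun i => x i.succ) with hb
  have hstep : ∀ (n : ℕ) (i : Fin k), dist ((barycentric μ)^[n] x i.castSucc)
      ((barycentric μ)^[n] x i.succ) ≤ b * ρ ^ n := by
    intro n
    induction n with
    | zero => simpa using dist_le_pi_dist (fun i : Fin k => x i.castSucc) (fun i => x i.succ)
    | succ n ih =>
      intro i
      rw [Function.iterate_succ_apply']
      refine (hρ.dist_barycentric_succ_le (h.barycentric_mem hr0 hx n) i).trans ?_
      calc _ ≤ ρ * (b * ρ ^ n) := mul_le_mul_of_nonneg_left (ih i) hρ.1.le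
        _ = _ := by ring
  have hdiam : ∀ (n : ℕ) (i j : Fin (k + 1)), dist ((barycentric μ)^[n] x i)
      ((barycentric μ)^[n] x j) ≤ 2 * k * b * ρ ^ n := fun n i j =>
    (dist_coord_le (hstep n) i j).trans (by rw [mul_assoc (2 * (k : ℝ))])
  have hC : ∀ n : ℕ, 0 ≤ 2 * k * b * ρ ^ n := fun n => dist_nonneg.trans (hdiam n 0 0)
  have hcauchy : CauchySeq fun n : ℕ => (barycentric μ)^[n] x := by
    refine cauchySeq_of_le_geometric ρ (2 * k * b) hρ.2.1 fun n => ?_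
    rw [dist_comm, Function.iterate_succ_apply']
    exact (dist_pi_le_iff (hC n)).2 fun i =>
      h.dist_le_of_forall (hC n) fun j => hdiam n _ _
  obtain ⟨y, hy⟩ := cauchySeq_tendsto_of_complete hcauchy
  refine ⟨y 0, ?_⟩
  suffices e : (fun _ => y 0) = y by rwa [e]
  funext i
  have h1 : Tendsto (fun n : ℕ => dist ((barycentric μ)^[n] x 0) ((barycentric μ)^[n] x i)) atTop
      (𝓝 (dist (y 0) (y i))) := ((tendsto_pi_nhds.1 hy) 0).dist ((tendsto_pi_nhds.1 hy) i)
  have h2 : Tendsto (fun n : ℕ => 2 * k * b * ρ ^ n) atTop (𝓝 0) := by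
    simpa using (tendsto_pow_atTop_nhds_zero_of_lt_one hρ.1.le hρ.2.1).const_mul (2 * k * b)
  exact dist_le_zero.1 (le_of_tendsto_of_tendsto' h1 h2 fun n => hdiam n 0 i)

theorem IsBddContractive.exists_betaExtension [CompleteSpace X] {μ : (Fin k → X) → X}
    (h : IsBddContractive μ) :
    ∃ ν : (Fin (k + 1) → X) → X, IsBddContractive ν ∧ IsBetaExtension μ ν := by
  choose ν hν using h.exists_tendsto
  have hcoord : ∀ x, Tendsto (fun n : ℕ => (barycentric μ)^[n] x 0) atTop (𝓝 (ν x)) :=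
    fun x => tendsto_pi_nhds.1 (hν x) 0
  have hmean : IsMean ν := by
    intro z
    have hfix : ∀ n : ℕ, (barycentric μ)^[n] (fun _ => z) = fun _ => z :=
      Function.iterate_fixed (funext fun _ => h.isMean z)
    exact tendsto_nhds_unique (hcoord fun _ => z) (by simp [hfix])
  refine ⟨ν, ⟨hmean, fun x y _ _ => ?_, fun S hS => ?_⟩, h.isTopologicalMean, hmean, hν⟩
  · exact le_of_tendsto' ((hcoord x).dist (hcoord y)) fun n =>
      (dist_le_pi_dist _ _ 0).trans (h.dist_barycentric_iterate_le x y n)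
  · obtain ⟨ρ, hρ⟩ := h.contractive S hS
    refine ⟨ρ, hρ.1, hρ.2.1, fun x y j hx hy hxy => ?_⟩
    have h0 : 0 ≤ ρ * dist (x j) (y j) := mul_nonneg hρ.1.le dist_nonneg
    -- the contraction happens at the first application of `β_μ`; all others are nonexpansive
    have h1 : dist (barycentric μ x) (barycentric μ y) ≤ ρ * dist (x j) (y j) := by
      refine (dist_pi_le_iff h0).2 fun i => ?_
      rcases eq_or_ne i j with rfl | hij
      · have : i.removeNth x = i.removeNth y := funext fun l => hxy _ (Fin.succAbove_ne i l)
        simp only [barycentric, this, dist_self]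
        exact h0
      · obtain ⟨l, rfl⟩ := Fin.exists_succAbove_eq hij.symm
        exact hρ.2.2 (i.removeNth x) (i.removeNth y) l (fun _ => hx _) (fun _ => hy _)
          fun m hm => hxy _ fun e => hm (Fin.succAbove_right_injective e)
    refine le_of_tendsto' (((tendsto_add_atTop_iff_nat 1).2 (hcoord x)).dist
      ((tendsto_add_atTop_iff_nat 1).2 (hcoord y))) fun n => ?_
    rw [Function.iterate_succ_apply, Function.iterate_succ_apply]
    exact ((dist_le_pi_dist _ _ 0).trans (h.dist_barycentric_iterate_le _ _ n)).trans h1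

theorem IsBddContractive.inductivelyBetaExtends [CompleteSpace X] [Nonempty X]
    {μ : (Fin 2 → X) → X} (h : IsBddContractive μ) : InductivelyBetaExtends μ := by
  let N : (n : ℕ) → {ν : (Fin (n + 2) → X) → X // IsBddContractive ν} := fun n =>
    Nat.rec ⟨μ, h⟩ (fun _ ν => ⟨ν.2.exists_betaExtension.choose,
      ν.2.exists_betaExtension.choose_spec.1⟩) n
  have hN : ∀ n, IsBetaExtension (N n).1 (N (n + 1)).1 := fun n =>
    (N n).2.exists_betaExtension.choose_spec.2
  let M : (n : ℕ) → (Fin n → X) → X := fun n => match n with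
    | 0 => fun _ => Classical.arbitrary X
    | 1 => fun x => x 0
    | n + 2 => (N n).1
  refine ⟨M, rfl, fun n hn => ?_⟩
  obtain ⟨m, rfl⟩ := Nat.exists_eq_add_of_le' hn
  exact ⟨(N m).2.isTopologicalMean, hN m⟩

/-! ### Iterated composition of binary means -/

theorem IsBddContractive.binary_dist_le {σ : X → X → X} (h : IsBddContractive (ofBinary σ))
    {a b a' b' : X} {r : ℝ} (ha : dist a a' ≤ r) (hb : dist b b' ≤ r) :
    dist (σ a b) (σ a' b') ≤ r := by
  have h1 := h.dist_le ![a, b] ![a', b']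
  refine h1.trans ((dist_pi_le_iff (dist_nonneg.trans ha)).2 fun i => ?_)
  fin_cases i
  · exact ha
  · exact hb

/-- Criterion for a binary mean: nonexpansive, and contractive in each variable on bounded sets. -/
theorem isBddContractive_ofBinary {σ : X → X → X} (hmean : ∀ a, σ a a = a)
    (hne : ∀ {a b a' b' : X} {r : ℝ}, dist a a' ≤ r → dist b b' ≤ r → dist (σ a b) (σ a' b') ≤ r)
    (hcon : ∀ S : Set X, Bornology.IsBounded S → ∃ ρ : ℝ, 0 < ρ ∧ ρ < 1 ∧
      ∀ a ∈ S, ∀ a' ∈ S, ∀ b ∈ S, dist (σ a b) (σ a' b) ≤ ρ * dist a a' ∧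
        dist (σ b a) (σ b a') ≤ ρ * dist a a') :
    IsBddContractive (ofBinary σ) where
  isMean := hmean
  nonexpansive x y _ _ := hne (dist_le_pi_dist x y 0) (dist_le_pi_dist x y 1)
  contractive S hS := by
    obtain ⟨ρ, h0, h1, h⟩ := hcon S hS
    refine ⟨ρ, h0, h1, fun x y j hx hy hxy => ?_⟩
    fin_cases j
    · have e : x 1 = y 1 := hxy 1 (by simp)
      simpa [ofBinary, e] using (h _ (hx 0) _ (hy 0) _ (hy 1)).1
    · have e : x 0 = y 0 := hxy 0 (by simp)
      simpa [ofBinary, e] using (h _ (hx 1) _ (hy 1) _ (hy 0)).2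

theorem dist_iterPair_le {σ τ : X → X → X} (hσ : IsBddContractive (ofBinary σ))
    (hτ : IsBddContractive (ofBinary τ)) {x y x' y' : X} {r : ℝ}
    (h1 : dist (σ x y) (σ x' y') ≤ r) (h2 : dist (τ x y) (τ x' y') ≤ r) (n : ℕ) :
    dist (iterPair σ τ x y n).1 (iterPair σ τ x' y' n).1 ≤ r ∧
      dist (iterPair σ τ x y n).2 (iterPair σ τ x' y' n).2 ≤ r := by
  induction n with
  | zero => exact ⟨h1, h2⟩
  | succ n ih => exact ⟨hσ.binary_dist_le ih.1 ih.2, hτ.binary_dist_le ih.1 ih.2⟩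

/-- If `d(σ(x, y), τ(x, y)) ≤ c d(x, y)` with `c < 1`, the iterated composition of `σ` and `τ`
exists, and it inherits nonexpansivity and contractivity on bounded sets from `σ` and `τ`. -/
theorem exists_iteratedComposition [CompleteSpace X] {σ τ : X → X → X} {c : ℝ} (hc0 : 0 ≤ c)
    (hc1 : c < 1) (hσ : IsBddContractive (ofBinary σ)) (hτ : IsBddContractive (ofBinary τ))
    (h : ∀ x y, dist (σ x y) (τ x y) ≤ c * dist x y) :
    ∃ μ : X → X → X, IsIteratedComposition σ τ μ ∧ IsBddContractive (ofBinary μ) := by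
  have hgap : ∀ x y n, dist (iterPair σ τ x y n).1 (iterPair σ τ x y n).2
      ≤ dist (σ x y) (τ x y) * c ^ n := by
    intro x y n
    induction n with
    | zero => simp [iterPair]
    | succ n ih =>
      refine (h _ _).trans ?_
      calc _ ≤ c * (dist (σ x y) (τ x y) * c ^ n) := mul_le_mul_of_nonneg_left ih hc0
        _ = _ := by ring
  have hlim : ∀ x y, ∃ z, Tendsto (fun n => (iterPair σ τ x y n).1) atTop (𝓝 z) := by
    intro x y
    refine cauchySeq_tendsto_of_complete
      (cauchySeq_of_le_geometric c (dist (σ x y) (τ x y)) hc1 fun n => ?_)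
    -- `a = σ(a, a)` and `σ(a, b)` are at most `d(a, b)` apart
    have e : σ (iterPair σ τ x y n).1 (iterPair σ τ x y n).1 = (iterPair σ τ x y n).1 :=
      hσ.isMean _
    refine le_trans ?_ (hgap x y n)
    conv_lhs => arg 1; rw [← e]
    exact hσ.binary_dist_le (by simp) le_rfl
  choose μ hμ using hlim
  have hμ2 : ∀ x y, Tendsto (fun n => (iterPair σ τ x y n).2) atTop (𝓝 (μ x y)) := by
    intro x y
    refine (hμ x y).congr_dist (squeeze_zero (fun _ => dist_nonneg) (hgap x y) ?_)
    simpa using (tendsto_pow_atTop_nhds_zero_of_lt_one hc0 hc1).const_mul (dist (σ x y) (τ x y))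
  have hmean : ∀ x, μ x x = x := by
    intro x
    have e1 : σ x x = x := hσ.isMean x
    have e2 : τ x x = x := hτ.isMean x
    have hfix : ∀ n, iterPair σ τ x x n = (x, x) := by
      intro n
      induction n with
      | zero => simp [iterPair, e1, e2]
      | succ n ih => simp [iterPair, ih, e1, e2]
    exact tendsto_nhds_unique (hμ x x) (by simp [hfix])
  have hdist : ∀ {x y x' y' : X} {r : ℝ}, dist (σ x y) (σ x' y') ≤ r →
      dist (τ x y) (τ x' y') ≤ r → dist (μ x y) (μ x' y') ≤ r := fun h1 h2 =>
    le_of_tendsto' ((hμ _ _).dist (hμ _ _)) fun n => (dist_iterPair_le hσ hτ h1 h2 n).1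
  refine ⟨μ, ⟨hmean, fun x y => ⟨hμ x y, hμ2 x y⟩⟩, hmean, fun x y _ _ => ?_, fun S hS => ?_⟩
  · exact hdist (hσ.dist_le x y) (hτ.dist_le x y)
  · obtain ⟨ρ₁, h1⟩ := hσ.contractive S hS
    obtain ⟨ρ₂, h2⟩ := hτ.contractive S hS
    refine ⟨max ρ₁ ρ₂, lt_max_of_lt_left h1.1, max_lt h1.2.1 h2.2.1, fun x y j hx hy hxy => ?_⟩
    refine hdist ((h1.2.2 x y j hx hy hxy).trans ?_) ((h2.2.2 x y j hx hy hxy).trans ?_)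
    · exact mul_le_mul_of_nonneg_right (le_max_left _ _) dist_nonneg
    · exact mul_le_mul_of_nonneg_right (le_max_right _ _) dist_nonneg

end Abstract

end Means

namespace PosDefOp

/-! ### Quadratic forms -/

section Forms

variable {𝕜 E : Type*} [RCLike 𝕜] [NormedAddCommGroup E] [InnerProductSpace 𝕜 E]

/-- The quadratic form `x ↦ ⟪A x, x⟫` of `A`. -/
def form (A : PosDefOp 𝕜 E) (x : E) : ℝ := RCLike.re (inner 𝕜 (A.1 x) x)

theorem form_nonneg (A : PosDefOp 𝕜 E) (x : E) : 0 ≤ A.form x :=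
  A.isPositive.re_inner_nonneg_left x

theorem inner_swap (A : PosDefOp 𝕜 E) (x y : E) : inner 𝕜 (A.1 x) y = inner 𝕜 x (A.1 y) :=
  A.isSymmetric x y

theorem re_inner_swap (A : PosDefOp 𝕜 E) (x y : E) :
    RCLike.re (inner 𝕜 (A.1 x) y) = RCLike.re (inner 𝕜 (A.1 y) x) := by
  rw [inner_swap, inner_re_symm]

theorem form_ofReal_smul (A : PosDefOp 𝕜 E) (r : ℝ) (x : E) :
    A.form ((r : 𝕜) • x) = r ^ 2 * A.form x := by
  simp only [form, map_smul, inner_smul_left, inner_smul_right, RCLike.conj_ofReal,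
    RCLike.re_ofReal_mul]
  ring

theorem ext_form {A B : PosDefOp 𝕜 E} (h : ∀ x, A.form x = B.form x) : A = B :=
  Subtype.ext (le_antisymm ((le_iff A.isSymmetric B.isSymmetric).2 fun x => (h x).le)
    ((le_iff B.isSymmetric A.isSymmetric).2 fun x => (h x).ge))

/-- The identity operator as an element of `Ω`. -/
def one : PosDefOp 𝕜 E :=
  ⟨1, (ContinuousLinearMap.nonneg_iff_isPositive _).2 ContinuousLinearMap.isPositive_one,
    isUnit_one⟩

theorem form_one (x : E) : (one : PosDefOp 𝕜 E).form x = ‖x‖ ^ 2 := by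
  simp [form, one]

/-! ### The Thompson metric -/

/-- The Thompson distance in terms of forms. The hypothesis `0 ≤ t` makes this true also in the
zero space, where `M` is a junk value and all distances vanish. -/
theorem dist_le_iff {A B : PosDefOp 𝕜 E} {t : ℝ} (ht : 0 ≤ t) :
    dist A B ≤ t ↔ ∀ x, A.form x ≤ Real.exp t * B.form x ∧ B.form x ≤ Real.exp t * A.form x := by
  rcases subsingleton_or_nontrivial E with hE | hE
  · have hAB : A = B := Subtype.ext (Subsingleton.elim _ _)
    subst hAB
    simp only [dist_self, ht, true_iff]
    intro x
    simp [form, Subsingleton.elim x 0]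
  · have h : ∀ A B : PosDefOp 𝕜 E,
        Real.log (M A B) ≤ t ↔ ∀ x, A.form x ≤ Real.exp t * B.form x := by
      intro A B
      constructor
      · intro h x
        refine ((le_smul_iff _ _ _).1 (le_M_smul A B) x).trans ?_
        exact mul_le_mul_of_nonneg_right ((Real.log_le_iff_le_exp (M_pos A B)).1 h)
          (B.form_nonneg x)
      · intro h
        rw [Real.log_le_iff_le_exp (M_pos A B)]
        exact M_le (Real.exp_pos t) ((le_smul_iff _ _ _).2 h)
    rw [dist_def, thompsonDist, max_le_iff, h, h, forall_and]

theorem form_le_of_dist_le {A B : PosDefOp 𝕜 E} {t : ℝ} (h : dist A B ≤ t) (x : E) :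
    A.form x ≤ Real.exp t * B.form x :=
  ((dist_le_iff (dist_nonneg.trans h)).1 h x).1

theorem form_le_exp_dist (A B : PosDefOp 𝕜 E) (x : E) :
    A.form x ≤ Real.exp (dist A B) * B.form x :=
  form_le_of_dist_le le_rfl x

theorem form_le_norm (A : PosDefOp 𝕜 E) (x : E) : A.form x ≤ ‖A.1‖ * ‖x‖ ^ 2 :=
  re_inner_le_norm A.1 x

/-- On norm-bounded parts of `Ω` the norm distance is controlled by the Thompson distance. -/
theorem norm_val_sub_le (A B : PosDefOp 𝕜 E) :
    ‖A.1 - B.1‖ ≤ 3 * ((Real.exp (dist A B) - 1) * Real.exp (dist A B) * ‖B.1‖) := by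
  set t := dist A B with ht
  have ht0 : 0 ≤ t := dist_nonneg
  have he : 1 ≤ Real.exp t := Real.one_le_exp ht0
  rcases ht0.eq_or_lt with h0 | h0
  · have : A = B := dist_eq_zero.1 (ht.symm.trans h0.symm)
    simp [this, ← h0]
  rcases subsingleton_or_nontrivial E with hE | hE
  · rw [show A.1 - B.1 = 0 from Subsingleton.elim _ _, norm_zero]
    have := sub_nonneg.2 he
    positivity
  have hB : 0 < ‖B.1‖ := norm_pos_iff.2 fun h => by
    obtain ⟨x, hx⟩ := exists_ne (0 : E)
    have := B.re_inner_pos hx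
    simp [h] at this
  set δ : ℝ := (Real.exp t - 1) * Real.exp t * ‖B.1‖ with hδ
  have he1 : 0 < Real.exp t - 1 := by linarith [Real.add_one_lt_exp h0.ne']
  have hδ0 : 0 < δ := by positivity
  have hup : ∀ x, A.form x - B.form x ≤ δ * ‖x‖ ^ 2 := by
    intro x
    calc A.form x - B.form x ≤ (Real.exp t - 1) * B.form x := by
          linarith [form_le_exp_dist A B x]
      _ ≤ (Real.exp t - 1) * (Real.exp t * (‖B.1‖ * ‖x‖ ^ 2)) := by
          gcongr
          have := B.form_le_norm x
          have : 0 ≤ ‖B.1‖ * ‖x‖ ^ 2 := by positivity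
          nlinarith
      _ = _ := by rw [hδ]; ring
  have hlo : ∀ x, B.form x - A.form x ≤ δ * ‖x‖ ^ 2 := by
    intro x
    have h1 := form_le_exp_dist A B x
    have h2 := form_le_exp_dist B A x
    rw [dist_comm, ← ht] at h2
    calc B.form x - A.form x ≤ (Real.exp t - 1) * A.form x := by linarith
      _ ≤ (Real.exp t - 1) * (Real.exp t * (‖B.1‖ * ‖x‖ ^ 2)) := by
          gcongr
          exact h1.trans (mul_le_mul_of_nonneg_left (B.form_le_norm x) (Real.exp_pos t).le)
      _ = _ := by rw [hδ]; ring
  -- `A - B + δ` is positive and at most `2δ`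
  have hre : ∀ x, RCLike.re (inner 𝕜 ((A.1 - B.1 + (δ : 𝕜) • (1 : E →L[𝕜] E)) x) x)
      = A.form x - B.form x + δ * ‖x‖ ^ 2 := by
    intro x
    rw [add_apply, inner_add_left, map_add, re_inner_smul_one, sub_apply, inner_sub_left, map_sub]
    rfl
  have hn : ‖A.1 - B.1 + (δ : 𝕜) • (1 : E →L[𝕜] E)‖ ≤ 2 * δ := by
    refine norm_le ⟨LinearMap.IsSymmetric.add (LinearMap.IsSymmetric.sub A.isSymmetric
      B.isSymmetric) (isSymmetric_smul_one δ), fun x => ?_⟩ (by positivity) fun x => ?_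
    · change 0 ≤ RCLike.re (inner 𝕜 ((A.1 - B.1 + (δ : 𝕜) • (1 : E →L[𝕜] E)) x) x)
      rw [hre]
      linarith [hlo x]
    · rw [hre]
      linarith [hup x]
  calc ‖A.1 - B.1‖ = ‖(A.1 - B.1 + (δ : 𝕜) • (1 : E →L[𝕜] E)) - (δ : 𝕜) • (1 : E →L[𝕜] E)‖ := by
        rw [add_sub_cancel_right]
    _ ≤ 2 * δ + δ * 1 := by
        refine (norm_sub_le _ _).trans (add_le_add hn ?_)
        rw [norm_smul, RCLike.norm_ofReal, abs_of_pos hδ0]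
        exact mul_le_mul_of_nonneg_left ContinuousLinearMap.norm_id_le hδ0.le
    _ = 3 * δ := by ring

theorem norm_sub_bound_tendsto {ι : Type*} {l : Filter ι} {t : ι → ℝ} (h : Tendsto t l (𝓝 0))
    (C : ℝ) : Tendsto (fun i => 3 * ((Real.exp (t i) - 1) * Real.exp (t i) * C)) l (𝓝 0) := by
  have h1 : Tendsto (fun i => Real.exp (t i)) l (𝓝 1) := by
    rw [← Real.exp_zero]
    exact (Real.continuous_exp.tendsto 0).comp h
  simpa using ((((h1.sub_const 1).mul h1).mul_const C).const_mul 3)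

theorem continuous_val : Continuous fun A : PosDefOp 𝕜 E => A.1 := by
  rw [continuous_iff_continuousAt]
  intro B
  refine tendsto_iff_norm_sub_tendsto_zero.2 (squeeze_zero (fun _ => norm_nonneg _)
    (fun A => norm_val_sub_le A B) (norm_sub_bound_tendsto ?_ _))
  exact tendsto_iff_dist_tendsto_zero.1 tendsto_id

theorem tendsto_ofCLM {ι : Type*} {l : Filter ι} {u : ι → PosDefOp 𝕜 E} {A : PosDefOp 𝕜 E}
    (h : Tendsto u l (𝓝 A)) : Tendsto (fun i => ContinuousLinearMapWOT.ofCLM (u i).1) l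
      (𝓝 (ContinuousLinearMapWOT.ofCLM A.1)) :=
  (ContinuousLinearMapWOT.continuous_ofCLM.tendsto _).comp ((continuous_val.tendsto A).comp h)

/-- The Thompson metric is complete: a Cauchy sequence is Cauchy in norm, and the order relations
between its members pass to the norm limit. -/
instance [CompleteSpace E] : CompleteSpace (PosDefOp 𝕜 E) := by
  refine Metric.complete_of_cauchySeq_tendsto fun u hu => ?_
  obtain ⟨R, hR0, hR⟩ := cauchySeq_bdd hu
  have hbound : ∀ n, ‖(u n).1‖ ≤ Real.exp R * ‖(u 0).1‖ + 1 := by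
    intro n
    refine norm_le (u n).isPositive (by positivity) fun z => ?_
    calc (u n).form z ≤ Real.exp R * (u 0).form z := form_le_of_dist_le (hR n 0).le z
      _ ≤ Real.exp R * (‖(u 0).1‖ * ‖z‖ ^ 2) := by gcongr; exact form_le_norm _ _
      _ ≤ _ := by nlinarith [sq_nonneg ‖z‖]
  have hcauchy : CauchySeq fun n => (u n).1 := by
    rw [cauchySeq_iff_tendsto_dist_atTop_0] at hu ⊢
    refine squeeze_zero (fun _ => dist_nonneg) (fun p => ?_)
      (norm_sub_bound_tendsto hu (Real.exp R * ‖(u 0).1‖ + 1))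
    rw [dist_eq_norm]
    refine (norm_val_sub_le _ _).trans ?_
    have := sub_nonneg.2 (Real.one_le_exp (dist_nonneg (x := u p.1) (y := u p.2)))
    gcongr
    exact hbound _
  obtain ⟨L, hL⟩ := cauchySeq_tendsto_of_complete hcauchy
  have hinner : ∀ x y, Tendsto (fun n => inner 𝕜 ((u n).1 x) y) atTop (𝓝 (inner 𝕜 (L x) y)) :=
    fun x y => (((ContinuousLinearMap.apply 𝕜 E x).continuous.tendsto L).comp hL).inner
      tendsto_const_nhds
  have hsymm : L.IsSymmetric := by
    intro x y
    have h1 := (hinner y x).star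
    refine tendsto_nhds_unique (hinner x y) (h1.congr' ?_ |>.trans ?_)
    · exact Eventually.of_forall fun n =>
        (inner_conj_symm _ _).trans ((u n).inner_swap x y).symm
    · exact le_of_eq (congrArg 𝓝 (inner_conj_symm _ _))
  have hform : ∀ x, Tendsto (fun n => (u n).form x) atTop (𝓝 (RCLike.re (inner 𝕜 (L x) x))) :=
    fun x => (RCLike.continuous_re.tendsto _).comp (hinner x x)
  obtain ⟨c, hc, hlow⟩ := (u 0).exists_lower
  have hpos : IsStrictlyPositive L := by
    refine isStrictlyPositive_of_lower hsymm (c := (Real.exp R)⁻¹ * c) (by positivity) fun x =>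
      ge_of_tendsto' (hform x) fun n => ?_
    rw [mul_assoc, inv_mul_le_iff₀ (Real.exp_pos R)]
    exact (hlow x).trans (form_le_of_dist_le (hR 0 n).le x)
  refine ⟨⟨L, hpos⟩, Metric.tendsto_atTop.2 fun ε hε => ?_⟩
  obtain ⟨N, hN⟩ := Metric.cauchySeq_iff.1 hu (ε / 2) (by positivity)
  refine ⟨N, fun n hn => lt_of_le_of_lt ((dist_le_iff (by positivity)).2 fun x => ⟨?_, ?_⟩)
    (half_lt_self hε)⟩
  · refine ge_of_tendsto ((hform x).const_mul _) ?_
    filter_upwards [eventually_ge_atTop N] with m hm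
    exact form_le_of_dist_le (hN n hn m hm).le x
  · refine le_of_tendsto (hform x) ?_
    filter_upwards [eventually_ge_atTop N] with m hm
    exact form_le_of_dist_le (hN m hm n hn).le x

/-- The order interval `[(1/n) I, n I]` is the Thompson ball of radius `log n` around `I`. -/
theorem orderInterval_eq_closedBall {n : ℕ} (hn : 1 ≤ n) :
    orderInterval 𝕜 E n = Metric.closedBall one (Real.log n) := by
  have hn0 : (0 : ℝ) < n := by exact_mod_cast hn
  ext A
  rw [Metric.mem_closedBall, dist_le_iff (Real.log_natCast_nonneg n), Real.exp_log hn0,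
    forall_and, and_comm]
  refine and_congr ?_ ?_
  · rw [le_iff (isSymmetric_smul_one _) A.isSymmetric]
    refine forall_congr' fun x => ?_
    rw [re_inner_smul_one, form_one, one_div, inv_mul_le_iff₀ hn0]
    rfl
  · rw [le_iff A.isSymmetric (isSymmetric_smul_one _)]
    refine forall_congr' fun x => ?_
    rw [re_inner_smul_one, form_one]
    rfl

/-! ### Riccati inequalities -/

/-- Monotonicity of the square root in a form adapted to the Riccati equation: for positive
definite `P`, the map `X ↦ X P X` reflects the order. With `m > 1` the least number with
`X ≤ m Y`, expanding `X P X ≤ Y P Y` around `X = m Y - F` bounds the form of `F` below by a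
positive multiple of that of `Y`, so that `m` was not least. -/
theorem form_le_of_riccati_le {P X Y : PosDefOp 𝕜 E}
    (h : ∀ x, P.form (X.1 x) ≤ P.form (Y.1 x)) (x : E) : X.form x ≤ Y.form x := by
  rcases subsingleton_or_nontrivial E with hE | hE
  · simp [form, Subsingleton.elim x 0]
  have hM : ∀ x, X.form x ≤ M X Y * Y.form x := (le_smul_iff _ _ _).1 (le_M_smul X Y)
  suffices hm : M X Y ≤ 1 from (hM x).trans (by nlinarith [Y.form_nonneg x])
  by_contra! hm
  set m : ℝ := M X Y with hmdef
  have hm0 : 0 < m := by linarith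
  obtain ⟨p, hp, hPlow⟩ := P.exists_lower
  obtain ⟨y, hy, hYlow⟩ := Y.exists_lower
  set F : E →L[𝕜] E := (m : 𝕜) • Y.1 - X.1 with hF
  have hFform : ∀ x, RCLike.re (inner 𝕜 (F x) x) = m * Y.form x - X.form x := by
    intro x
    rw [hF, sub_apply, inner_sub_left, map_sub, re_inner_smul]
    rfl
  have hFpos : F.IsPositive := by
    refine ⟨LinearMap.IsSymmetric.sub (isSymmetric_smul m Y.isSymmetric) X.isSymmetric,
      fun x => ?_⟩
    change 0 ≤ RCLike.re (inner 𝕜 (F x) x)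
    rw [hFform]
    linarith [hM x]
  set q : ℝ := ‖F‖ + 1 with hq
  have hq0 : 0 < q := by positivity
  have hFsq : ∀ x, ‖F x‖ ^ 2 ≤ q * RCLike.re (inner 𝕜 (F x) x) :=
    norm_sq_le hFpos hq0 fun z => (re_inner_le_norm F z).trans (by
      gcongr; simp [hq])
  set K : ℝ := ‖P.1‖ + 1 with hK
  have hK0 : 0 < K := by positivity
  have hYsq : ∀ x, y * Y.form x ≤ ‖Y.1 x‖ ^ 2 := by
    intro x
    have h1 : Y.form x ≤ ‖Y.1 x‖ * ‖x‖ :=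
      (RCLike.re_le_norm _).trans (norm_inner_le_norm _ _)
    have h2 := hYlow x
    change y * ‖x‖ ^ 2 ≤ Y.form x at h2
    nlinarith [sq_nonneg (‖Y.1 x‖ - y * ‖x‖), norm_nonneg x, norm_nonneg (Y.1 x)]
  -- the expansion of `X P X = (m Y - F) P (m Y - F)`
  have hexp : ∀ x, (m ^ 2 - 1) * P.form (Y.1 x) ≤
      2 * m * RCLike.re (inner 𝕜 (P.1 (Y.1 x)) (F x)) := by
    intro x
    have e : X.1 x = (m : 𝕜) • Y.1 x - F x := by simp [hF]
    have h1 := h x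
    rw [e] at h1
    have h2 : P.form ((m : 𝕜) • Y.1 x - F x) = m ^ 2 * P.form (Y.1 x)
        - 2 * m * RCLike.re (inner 𝕜 (P.1 (Y.1 x)) (F x)) + P.form (F x) := by
      simp only [form, map_sub, map_smul, inner_sub_left, inner_sub_right, inner_smul_left,
        inner_smul_right, RCLike.conj_ofReal, RCLike.re_ofReal_mul, P.re_inner_swap (F x)]
      ring
    have h3 := P.form_nonneg (F x)
    linarith
  set a : ℝ := (m ^ 2 - 1) * p / (2 * m * K) with ha
  have ha0 : 0 < a := by
    have : 0 < m ^ 2 - 1 := by nlinarith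
    positivity
  have hlow : ∀ x, a * ‖Y.1 x‖ ≤ ‖F x‖ := by
    intro x
    have h1 : RCLike.re (inner 𝕜 (P.1 (Y.1 x)) (F x)) ≤ K * ‖Y.1 x‖ * ‖F x‖ := by
      refine ((RCLike.re_le_norm _).trans (norm_inner_le_norm _ _)).trans ?_
      gcongr
      refine (P.1.le_opNorm _).trans ?_
      gcongr
      simp [hK]
    have h2 : (m ^ 2 - 1) * (p * ‖Y.1 x‖ ^ 2) ≤ 2 * m * (K * ‖Y.1 x‖ * ‖F x‖) := by
      have : 0 < m ^ 2 - 1 := by nlinarith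
      calc _ ≤ (m ^ 2 - 1) * P.form (Y.1 x) := by gcongr; exact hPlow _
        _ ≤ _ := (hexp x).trans (by gcongr)
    rcases (norm_nonneg (Y.1 x)).eq_or_lt with h0 | h0
    · rw [← h0, mul_zero]
      exact norm_nonneg _
    · rw [ha, div_mul_eq_mul_div, div_le_iff₀ (by positivity)]
      refine le_of_mul_le_mul_right ?_ h0
      linarith
  set ε : ℝ := min (m / 2) (a ^ 2 * y / q) with hε
  have hε0 : 0 < ε := lt_min (by positivity) (by positivity)
  have hε1 : ε ≤ m / 2 := min_le_left _ _
  have hlt : m ≤ m - ε := by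
    refine M_le (by linarith) ((le_smul_iff _ _ _).2 fun x => ?_)
    change X.form x ≤ (m - ε) * Y.form x
    have h1 : a ^ 2 * (y * Y.form x) ≤ q * (m * Y.form x - X.form x) := by
      rw [← hFform]
      refine le_trans ?_ (hFsq x)
      calc _ ≤ a ^ 2 * ‖Y.1 x‖ ^ 2 := by gcongr; exact hYsq x
        _ = (a * ‖Y.1 x‖) ^ 2 := by ring
        _ ≤ _ := by gcongr; exact hlow x
    have h2 : ε * Y.form x ≤ a ^ 2 * y / q * Y.form x :=
      mul_le_mul_of_nonneg_right (min_le_right _ _) (Y.form_nonneg x)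
    have h3 : a ^ 2 * y / q * Y.form x ≤ m * Y.form x - X.form x := by
      rw [div_mul_eq_mul_div, div_le_iff₀ hq0]
      linarith
    linarith
  linarith

theorem eq_of_riccati {P X Y : PosDefOp 𝕜 E} (h : ∀ x, P.form (X.1 x) = P.form (Y.1 x)) : X = Y :=
  ext_form fun x => le_antisymm (form_le_of_riccati_le (fun x => (h x).le) x)
    (form_le_of_riccati_le (fun x => (h x).ge) x)

/-! ### Inverses -/

theorem inv_apply_self (A : PosDefOp 𝕜 E) (x : E) : A.inv.1 (A.1 x) = x := by
  have h : A.inv.1 * A.1 = 1 := IsUnit.val_inv_mul A.2.isUnit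
  rw [← mul_apply_eq_comp, h, one_apply_eq_self]

theorem apply_inv_self (A : PosDefOp 𝕜 E) (x : E) : A.1 (A.inv.1 x) = x := by
  have h : A.1 * A.inv.1 = 1 := IsUnit.mul_val_inv A.2.isUnit
  rw [← mul_apply_eq_comp, h, one_apply_eq_self]

theorem form_inv_apply (A : PosDefOp 𝕜 E) (x : E) : A.form (A.inv.1 x) = A.inv.form x := by
  rw [form, form, apply_inv_self, inner_re_symm]

theorem inv_form_apply (A : PosDefOp 𝕜 E) (x : E) : A.inv.form (A.1 x) = A.form x := by
  rw [form, form, inv_apply_self, inner_re_symm]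

theorem eq_inv_of_apply {A B : PosDefOp 𝕜 E} (h : ∀ x, A.1 (B.1 x) = x) : B = A.inv :=
  Subtype.ext (ContinuousLinearMap.ext fun x => by
    conv_rhs => rw [← h x]
    rw [inv_apply_self])

theorem inv_inv (A : PosDefOp 𝕜 E) : A.inv.inv = A :=
  (eq_inv_of_apply A.inv_apply_self).symm

/-- Inversion reverses the order. -/
theorem inv_form_le {A B : PosDefOp 𝕜 E} {r : ℝ} (hr : 0 < r)
    (h : ∀ x, A.form x ≤ r * B.form x) (x : E) : B.inv.form x ≤ r * A.inv.form x := by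
  -- expand `0 ≤ ⟪A z, z⟫` at `z = A⁻¹ x - r⁻¹ B⁻¹ x`
  have h0 := A.form_nonneg (A.inv.1 x - ((r⁻¹ : ℝ) : 𝕜) • B.inv.1 x)
  have h1 : A.form (A.inv.1 x - ((r⁻¹ : ℝ) : 𝕜) • B.inv.1 x)
      = A.inv.form x - 2 * r⁻¹ * B.inv.form x + r⁻¹ ^ 2 * A.form (B.inv.1 x) := by
    have e1 : RCLike.re (inner 𝕜 x (A.inv.1 x)) = A.inv.form x := inner_re_symm _ _
    have e2 : RCLike.re (inner 𝕜 x (B.inv.1 x)) = B.inv.form x := inner_re_symm _ _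
    have e3 : RCLike.re (inner 𝕜 (A.1 (B.inv.1 x)) (A.inv.1 x)) = B.inv.form x := by
      rw [inner_swap, apply_inv_self]; rfl
    rw [form, map_sub, map_smul, inner_sub_left, inner_sub_right, inner_sub_right, inner_smul_left,
      inner_smul_left, inner_smul_right, inner_smul_right, apply_inv_self]
    simp only [RCLike.conj_ofReal, map_sub, RCLike.re_ofReal_mul, e1, e2, e3]
    simp only [form]
    ring
  have h2 := h (B.inv.1 x)
  rw [form_inv_apply] at h2
  have h3 : r⁻¹ ^ 2 * A.form (B.inv.1 x) ≤ r⁻¹ * B.inv.form x := by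
    calc _ ≤ r⁻¹ ^ 2 * (r * B.inv.form x) := by gcongr
      _ = _ := by field_simp
  have h4 : r⁻¹ * B.inv.form x ≤ A.inv.form x := by linarith
  rwa [inv_mul_le_iff₀ hr] at h4

theorem dist_inv_inv_le (A B : PosDefOp 𝕜 E) : dist A.inv B.inv ≤ dist A B :=
  (dist_le_iff dist_nonneg).2 fun x =>
    ⟨inv_form_le (Real.exp_pos _) (fun y => by rw [dist_comm]; exact form_le_exp_dist B A y) x,
      inv_form_le (Real.exp_pos _) (form_le_exp_dist A B) x⟩

theorem dist_inv_inv (A B : PosDefOp 𝕜 E) : dist A.inv B.inv = dist A B :=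
  le_antisymm (dist_inv_inv_le A B) (by
    simpa only [inv_inv] using dist_inv_inv_le A.inv B.inv)

end Forms

section Means

variable {𝕜 E : Type*} [RCLike 𝕜] [NormedAddCommGroup E] [InnerProductSpace 𝕜 E] [CompleteSpace E]

/-! ### The geometric mean -/

theorem sqrt_apply_sqrt (A : PosDefOp 𝕜 E) (x : E) : A.sqrt.1 (A.sqrt.1 x) = A.1 x := by
  rw [← mul_apply_eq_comp, show A.sqrt.1 * A.sqrt.1 = A.1 from A.existsUnique_sqrt.choose_spec.1]

/-- The Riccati equation `G A⁻¹ G = B` for `G = A # B`. -/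
theorem geomMean_riccati (A B : PosDefOp 𝕜 E) (x : E) :
    (geomMean A B).1 (A.inv.1 ((geomMean A B).1 x)) = B.1 x := by
  have hA : ∀ z, A.inv.1 (A.sqrt.1 z) = A.sqrt.inv.1 z := fun z => by
    rw [← A.sqrt.apply_inv_self z, sqrt_apply_sqrt, inv_apply_self, A.sqrt.apply_inv_self]
  have hG : ∀ z, (geomMean A B).1 z
      = A.sqrt.1 ((conj A.sqrt.inv B).sqrt.1 (A.sqrt.1 z)) := fun z => rfl
  have hC : ∀ z, (conj A.sqrt.inv B).1 z = A.sqrt.inv.1 (B.1 (A.sqrt.inv.1 z)) := fun z => rfl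
  rw [hG x, hA, hG, apply_inv_self, sqrt_apply_sqrt, hC, inv_apply_self, apply_inv_self]

theorem inv_form_geomMean (A B : PosDefOp 𝕜 E) (x : E) :
    A.inv.form ((geomMean A B).1 x) = B.form x := by
  rw [form, ← inner_swap, geomMean_riccati]
  rfl

theorem geomMean_self (A : PosDefOp 𝕜 E) : geomMean A A = A :=
  eq_of_riccati (P := A.inv) fun x => by rw [inv_form_geomMean, inv_form_apply]

theorem geomMean_inv_inv (A B : PosDefOp 𝕜 E) :
    geomMean A.inv B.inv = (geomMean A B).inv := by
  refine eq_of_riccati (P := A) fun x => ?_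
  have h1 := inv_form_geomMean A.inv B.inv x
  rw [inv_inv] at h1
  have h2 : (geomMean A B).inv.1 x = A.inv.1 ((geomMean A B).1 (B.inv.1 x)) := by
    conv_lhs => rw [← B.apply_inv_self x, ← geomMean_riccati A B]
    rw [inv_apply_self]
  rw [h1, h2, form_inv_apply, inv_form_geomMean, form_inv_apply]

theorem form_rsmul (r : ℝ) (hr : 0 < r) (A : PosDefOp 𝕜 E) (x : E) :
    (rsmul r hr A).form x = r * A.form x :=
  re_inner_smul r A.1 x

/-- Joint monotonicity and homogeneity of the geometric mean. -/
theorem geomMean_form_le {A B C D : PosDefOp 𝕜 E} {r s t : ℝ} (hr : 0 < r) (hs : 0 < s)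
    (ht : 0 < t) (hrs : t ^ 2 = r * s) (hA : ∀ x, A.form x ≤ r * C.form x)
    (hB : ∀ x, B.form x ≤ s * D.form x) (x : E) :
    (geomMean A B).form x ≤ t * (geomMean C D).form x := by
  rw [← form_rsmul t ht]
  refine form_le_of_riccati_le (P := A.inv) (fun z => ?_) x
  change _ ≤ A.inv.form ((t : 𝕜) • (geomMean C D).1 z)
  rw [form_ofReal_smul, inv_form_geomMean, hrs]
  calc B.form z ≤ s * C.inv.form ((geomMean C D).1 z) := by
        rw [inv_form_geomMean]; exact hB z
    _ ≤ s * (r * A.inv.form ((geomMean C D).1 z)) := by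
        gcongr; exact inv_form_le hr hA _
    _ = _ := by ring

theorem dist_geomMean_le {A B C D : PosDefOp 𝕜 E} {s t : ℝ} (hA : dist A C ≤ s)
    (hB : dist B D ≤ t) : dist (geomMean A B) (geomMean C D) ≤ (s + t) / 2 := by
  have hs : 0 ≤ s := dist_nonneg.trans hA
  have ht : 0 ≤ t := dist_nonneg.trans hB
  have he : Real.exp ((s + t) / 2) ^ 2 = Real.exp s * Real.exp t := by
    rw [← Real.exp_nat_mul, ← Real.exp_add]
    congr 1
    push_cast
    ring
  refine (dist_le_iff (by positivity)).2 fun x => ⟨?_, ?_⟩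
  · exact geomMean_form_le (Real.exp_pos s) (Real.exp_pos t) (Real.exp_pos _) he
      (form_le_of_dist_le hA) (form_le_of_dist_le hB) x
  · rw [dist_comm] at hA hB
    exact geomMean_form_le (Real.exp_pos s) (Real.exp_pos t) (Real.exp_pos _) he
      (form_le_of_dist_le hA) (form_le_of_dist_le hB) x

theorem isBddContractive_geomMean :
    Means.IsBddContractive (Means.ofBinary (geomMean (𝕜 := 𝕜) (E := E))) := by
  refine Means.isBddContractive_ofBinary geomMean_self (fun h1 h2 => ?_) fun S _ =>
    ⟨1 / 2, by norm_num, by norm_num, fun a _ a' _ b _ => ⟨?_, ?_⟩⟩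
  · exact (dist_geomMean_le h1 h2).trans (by linarith)
  · exact (dist_geomMean_le le_rfl (dist_self b).le).trans (by linarith)
  · exact (dist_geomMean_le (dist_self b).le le_rfl).trans (by linarith)

/-! ### The arithmetic mean -/

theorem form_arithMean (A B : PosDefOp 𝕜 E) (x : E) :
    (arithMean A B).form x = (A.form x + B.form x) / 2 := by
  rw [arithMean, form_rsmul]
  have : (add A B).form x = A.form x + B.form x := by
    simp [form, add, inner_add_left]
  rw [this]
  ring

theorem arithMean_self (A : PosDefOp 𝕜 E) : arithMean A A = A :=
  ext_form fun x => by rw [form_arithMean]; ring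

theorem arithMean_comm (A B : PosDefOp 𝕜 E) : arithMean A B = arithMean B A :=
  ext_form fun x => by rw [form_arithMean, form_arithMean, add_comm]

theorem dist_arithMean_le {A B C D : PosDefOp 𝕜 E} {r : ℝ} (hA : dist A C ≤ r)
    (hB : dist B D ≤ r) : dist (arithMean A B) (arithMean C D) ≤ r := by
  refine (dist_le_iff (dist_nonneg.trans hA)).2 fun x => ?_
  have h1 := form_le_of_dist_le hA x
  have h2 := form_le_of_dist_le hB x
  have h3 := form_le_of_dist_le ((dist_comm _ _).le.trans hA) x
  have h4 := form_le_of_dist_le ((dist_comm _ _).le.trans hB) x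
  simp only [form_arithMean]
  constructor <;> linarith

/-- The function `s ↦ log ((K e ^ s + 1) / (K + 1))` has slope less than one on `[0, log K]`. -/
theorem convexComb_exp_le {K s : ℝ} (hK : 1 ≤ K) (hs : 0 ≤ s) (hsK : Real.exp s ≤ K) :
    (K * Real.exp s + 1) / (K + 1) ≤ Real.exp ((1 - 1 / ((K + 1) * K)) * s) := by
  have hK0 : 0 < K := by linarith
  set r := Real.exp s with hr
  have hr1 : 1 ≤ r := Real.one_le_exp hs
  have hr0 : 0 < r := Real.exp_pos s
  -- `w / r = 1 - (1 - 1/r) / (K + 1) ≤ 1 - s / ((K + 1) K) ≤ exp (- s / ((K + 1) K))`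
  have h1 : s ≤ r - 1 := by
    have := Real.add_one_le_exp s
    linarith
  have h2 : s / K ≤ (r - 1) / r := by
    rw [div_le_div_iff₀ hK0 hr0]
    have : 0 ≤ s * (K - r) := mul_nonneg hs (by linarith)
    have : s * K ≤ (r - 1) * K := by gcongr
    nlinarith
  have h3 : (K * r + 1) / (K + 1) = r * (1 - (r - 1) / r / (K + 1)) := by
    field_simp
    ring
  have h4 : Real.exp ((1 - 1 / ((K + 1) * K)) * s) = r * Real.exp (-(s / K / (K + 1))) := by
    rw [hr, ← Real.exp_add]
    congr 1
    field_simp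
    ring
  rw [h3, h4]
  gcongr
  have h5 := Real.add_one_le_exp (-(s / K / (K + 1)))
  have h6 : s / K / (K + 1) ≤ (r - 1) / r / (K + 1) := by gcongr
  linarith

theorem arithMean_form_le {A A' B : PosDefOp 𝕜 E} {K s : ℝ} (hK : 1 ≤ K) (hs : 0 ≤ s)
    (hsK : Real.exp s ≤ K) (hA : ∀ x, A.form x ≤ Real.exp s * A'.form x)
    (hB : ∀ x, A'.form x ≤ K * B.form x) (x : E) :
    (arithMean A B).form x ≤ Real.exp ((1 - 1 / ((K + 1) * K)) * s) * (arithMean A' B).form x := by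
  have h1 : (0 : ℝ) ≤ Real.exp s - 1 := by linarith [Real.one_le_exp hs]
  have h2 := hA x
  have h3 := mul_le_mul_of_nonneg_left (hB x) h1
  have h4 : Real.exp s * A'.form x + B.form x
      ≤ (K * Real.exp s + 1) / (K + 1) * (A'.form x + B.form x) := by
    rw [div_mul_eq_mul_div, le_div_iff₀ (by linarith)]
    linarith
  have h5 := mul_le_mul_of_nonneg_right (convexComb_exp_le hK hs hsK)
    (add_nonneg (A'.form_nonneg x) (B.form_nonneg x))
  rw [form_arithMean, form_arithMean]
  linarith

theorem isBddContractive_arithMean :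
    Means.IsBddContractive (Means.ofBinary (arithMean (𝕜 := 𝕜) (E := E))) := by
  refine Means.isBddContractive_ofBinary arithMean_self dist_arithMean_le fun S hS => ?_
  obtain ⟨C, hC⟩ := Metric.isBounded_iff.1 hS
  have hC' : ∀ ⦃a⦄, a ∈ S → ∀ ⦃b⦄, b ∈ S → dist a b ≤ max C 0 := fun a ha b hb =>
    (hC ha hb).trans (le_max_left _ _)
  set K : ℝ := Real.exp (max C 0) with hKdef
  have hK : 1 ≤ K := Real.one_le_exp (le_max_right _ _)
  have hρ1 : 1 < (K + 1) * K := by nlinarith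
  have hρ2 : 1 / ((K + 1) * K) < 1 := (div_lt_one (by positivity)).2 hρ1
  have key : ∀ a ∈ S, ∀ a' ∈ S, ∀ b ∈ S, dist (arithMean a b) (arithMean a' b)
      ≤ (1 - 1 / ((K + 1) * K)) * dist a a' := by
    intro a ha a' ha' b hb
    have hd : Real.exp (dist a a') ≤ K := Real.exp_le_exp.2 (hC' ha ha')
    refine (dist_le_iff (mul_nonneg (by linarith) dist_nonneg)).2 fun x => ⟨?_, ?_⟩
    · exact arithMean_form_le hK dist_nonneg hd (form_le_exp_dist a a')
        (form_le_of_dist_le (hC' ha' hb)) x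
    · exact arithMean_form_le hK dist_nonneg hd
        (form_le_of_dist_le (dist_comm a' a).le) (form_le_of_dist_le (hC' ha hb)) x
  refine ⟨1 - 1 / ((K + 1) * K), by linarith, by
    have : 0 < 1 / ((K + 1) * K) := by positivity
    linarith, fun a ha a' ha' b hb => ⟨key a ha a' ha' b hb, ?_⟩⟩
  rw [arithMean_comm b a, arithMean_comm b a']
  exact key a ha a' ha' b hb

/-- Comparing `A = A # A` and `B = B # B` with `A # B`, and `A # B` with `A # A` and `B # B`,
shows that `A # B` is within `d(A, B) / 2` of both `A` and `B`, hence of their mean. -/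
theorem dist_geomMean_arithMean_le (A B : PosDefOp 𝕜 E) :
    dist (geomMean A B) (arithMean A B) ≤ 1 / 2 * dist A B := by
  have h1 : dist (geomMean A B) A ≤ 1 / 2 * dist A B := by
    have := dist_geomMean_le (dist_self A).le (dist_comm B A).le
    rw [geomMean_self] at this
    linarith
  have h2 : dist (geomMean A B) B ≤ 1 / 2 * dist A B := by
    have := dist_geomMean_le (le_refl (dist A B)) (dist_self B).le
    rw [geomMean_self] at this
    linarith
  have := dist_arithMean_le h1 h2
  rwa [arithMean_self] at this

/-! ### The harmonic mean -/

theorem harmMean_eq (A B : PosDefOp 𝕜 E) : harmMean A B = (arithMean A.inv B.inv).inv := by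
  refine eq_inv_of_apply fun x => ?_
  change ((1 / 2 : ℝ) : 𝕜) • (add A.inv B.inv).1 (((2 : ℝ) : 𝕜) • (add A.inv B.inv).inv.1 x) = x
  rw [map_smul, apply_inv_self, smul_smul, ← RCLike.ofReal_mul]
  norm_num

theorem isBddContractive_harmMean :
    Means.IsBddContractive (Means.ofBinary (harmMean (𝕜 := 𝕜) (E := E))) := by
  have hA := isBddContractive_arithMean (𝕜 := 𝕜) (E := E)
  refine Means.isBddContractive_ofBinary (fun A => ?_) (fun h1 h2 => ?_) fun S hS => ?_
  · rw [harmMean_eq, arithMean_self, inv_inv]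
  · rw [harmMean_eq, harmMean_eq, dist_inv_inv]
    exact dist_arithMean_le ((dist_inv_inv _ _).le.trans h1) ((dist_inv_inv _ _).le.trans h2)
  · have hS' : Bornology.IsBounded (inv '' S) :=
      (LipschitzWith.of_dist_le_mul (K := 1) fun A B => by
        simp [dist_inv_inv]).isBounded_image hS
    obtain ⟨ρ, h0, h1, h⟩ := hA.contractive _ hS'
    refine ⟨ρ, h0, h1, fun a ha a' ha' b hb => ?_⟩
    have ha := Set.mem_image_of_mem inv ha
    have ha' := Set.mem_image_of_mem inv ha'
    have hb := Set.mem_image_of_mem inv hb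
    simp only [harmMean_eq, dist_inv_inv]
    rw [← dist_inv_inv a a', arithMean_comm b.inv, arithMean_comm b.inv, and_self]
    exact h ![a.inv, b.inv] ![a'.inv, b.inv] 0 (Fin.forall_fin_two.2 ⟨ha, hb⟩)
      (Fin.forall_fin_two.2 ⟨ha', hb⟩) (by simp [Fin.forall_fin_two])

theorem dist_geomMean_harmMean_le (A B : PosDefOp 𝕜 E) :
    dist (geomMean A B) (harmMean A B) ≤ 1 / 2 * dist A B := by
  rw [harmMean_eq, ← dist_inv_inv, inv_inv, ← geomMean_inv_inv, ← dist_inv_inv A B]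
  exact dist_geomMean_arithMean_le _ _

/-! ### Iterated composition of operator means -/

/-- The iterated composition of two operator means with `d(σ(A, B), τ(A, B)) ≤ d(A, B) / 2`, both
nonexpansive and contractive in each variable on bounded sets. -/
theorem exists_iteratedOpMean {σ τ : PosDefOp 𝕜 E → PosDefOp 𝕜 E → PosDefOp 𝕜 E}
    (hσ : Means.IsBddContractive (Means.ofBinary σ))
    (hτ : Means.IsBddContractive (Means.ofBinary τ))
    (h : ∀ A B, dist (σ A B) (τ A B) ≤ 1 / 2 * dist A B) :
    ∃ μ : PosDefOp 𝕜 E → PosDefOp 𝕜 E → PosDefOp 𝕜 E,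
      IsIteratedOpMean σ τ μ ∧
      (∀ n : ℕ, 1 ≤ n →
        Means.IsConvexFor (Means.ofBinary μ) (orderInterval 𝕜 E n) ∧
        Means.IsNonexpansiveOn (Means.ofBinary μ) (orderInterval 𝕜 E n) ∧
        ∃ ρ : ℝ, Means.IsCoordContractiveOn ρ (Means.ofBinary μ) (orderInterval 𝕜 E n)) ∧
      Means.InductivelyBetaExtends (Means.ofBinary μ) := by
  obtain ⟨μ, hμ, hcon⟩ :=
    Means.exists_iteratedComposition (by norm_num) (by norm_num) hσ hτ h
  have : Nonempty (PosDefOp 𝕜 E) := ⟨one⟩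
  refine ⟨μ, ⟨hμ, fun A B => ⟨tendsto_ofCLM (hμ.2 A B).1, tendsto_ofCLM (hμ.2 A B).2⟩⟩,
    fun n hn => ?_, hcon.inductivelyBetaExtends⟩
  rw [orderInterval_eq_closedBall hn]
  exact ⟨hcon.isConvexFor_closedBall _ (Real.log_natCast_nonneg n), fun x y _ _ => hcon.dist_le x y,
    hcon.contractive _ Metric.isBounded_closedBall⟩

end Means

end PosDefOp

theorem mainTheorem5 {𝕜 E : Type*} [RCLike 𝕜] [NormedAddCommGroup E] [InnerProductSpace 𝕜 E]
    [CompleteSpace E] :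
    (∃ AGM : PosDefOp 𝕜 E → PosDefOp 𝕜 E → PosDefOp 𝕜 E,
      PosDefOp.IsIteratedOpMean PosDefOp.geomMean PosDefOp.arithMean AGM ∧
      (∀ n : ℕ, 1 ≤ n →
        Means.IsConvexFor (Means.ofBinary AGM) (PosDefOp.orderInterval 𝕜 E n) ∧
        Means.IsNonexpansiveOn (Means.ofBinary AGM) (PosDefOp.orderInterval 𝕜 E n) ∧
        ∃ ρ : ℝ,
          Means.IsCoordContractiveOn ρ (Means.ofBinary AGM) (PosDefOp.orderInterval 𝕜 E n)) ∧
      Means.InductivelyBetaExtends (Means.ofBinary AGM)) ∧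
    (∃ HGM : PosDefOp 𝕜 E → PosDefOp 𝕜 E → PosDefOp 𝕜 E,
      PosDefOp.IsIteratedOpMean PosDefOp.geomMean PosDefOp.harmMean HGM ∧
      (∀ n : ℕ, 1 ≤ n →
        Means.IsConvexFor (Means.ofBinary HGM) (PosDefOp.orderInterval 𝕜 E n) ∧
        Means.IsNonexpansiveOn (Means.ofBinary HGM) (PosDefOp.orderInterval 𝕜 E n) ∧
        ∃ ρ : ℝ,
          Means.IsCoordContractiveOn ρ (Means.ofBinary HGM) (PosDefOp.orderInterval 𝕜 E n)) ∧
      Means.InductivelyBetaExtends (Means.ofBinary HGM)) :=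
  ⟨PosDefOp.exists_iteratedOpMean PosDefOp.isBddContractive_geomMean
      PosDefOp.isBddContractive_arithMean PosDefOp.dist_geomMean_arithMean_le,
    PosDefOp.exists_iteratedOpMean PosDefOp.isBddContractive_geomMean
      PosDefOp.isBddContractive_harmMean PosDefOp.dist_geomMean_harmMean_le⟩
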